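/- Let $d\ge 1$, $\Theta\subset\mathbb{R}^q$, and let $\{f_\theta:\theta\in\Theta\}$ be probability densities with respect to Lebesgue measure on $\mathbb{R}^d$, with $P_\theta(A)=\int_A f_\theta(y)\,dy$. Let $\theta_0$ be an interior point of $\Theta$, put $g=f_{\theta_0}$, and let $\xi_1,\xi_2,\dots$ be independent random vectors with density $g$. Let $\Theta_0\subset\operatorname{int}\Theta$ be a compact convex neighbourhood of $\theta_0$ such that, for every $\theta\in\Theta_0$, $P_\theta\ll P_{\theta_0}$ (i.e. $f_\theta=0$ almost everywhere on $\{g=0\}$). For $n\ge 2$ let $R_n=\min_{2\le j\le n}|\xi_1-\xi_j|$, let $B_n=\{y:|y-\xi_1|\le R_n\}$ be the nearest neighbour ball of $\xi=\xi_1$, and let $z_n(\theta)=nP_\theta(B_n)$. Let $\nabla f_\theta=(\partial f_\theta/\partial\theta_1,\dots,\partial f_\theta/\partial\theta_q)$. For a function $h$ on $(0,\infty)$ let $v(x)=h'(x)x$, $$\psi_n(\xi,\theta)=v(z_n(\theta))\,\frac{1}{P_\theta(B_n)}\int_{B_n}\nabla f_\theta(y)\,dy,\qquad \psi(\xi,\theta)=v\!\left(Z\,\frac{f_\theta(\xi)}{g(\xi)}\right)\frac{\nabla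 f_\theta(\xi)}{f_\theta(\xi)},$$ where $Z$ is exponentially distributed with mean $1$ and independent of $\xi$ (and $\psi_n=0$, $\psi=0$ where the denominator $P_\theta(B_n)$, respectively $f_\theta(\xi)$, vanishes), and let $\lambda_n(\theta)=E[\psi_n(\xi,\theta)]$ and $\lambda(\theta)=E[\psi(\xi,\theta)]$. Consider the functions $$h_1(x)=\ln x-x+1,\qquad h_2(x)=(1-x)\ln x,\qquad h_5(x)=\operatorname{sgn}(1-\alpha)\,(x^\alpha-\alpha x+\alpha-1)$$ and the following assumptions. (A2) For every $x$, $f_\theta(x)$ is twice continuously differentiable in $\theta$ at the points of $\Theta_0$, and $f_\theta(x)$ and its first and second order partial derivatives with respect to the components of $\theta$ are continuous in $(\theta,x)\in\Theta_0\times\mathbb{R}^d$. (A3) $E\left[\sup_{\theta\in\Theta_0}\left|\frac{\partial f_\theta(\xi)/\partial\theta_j}{g(\xi)}\right|^2\right]<\infty$ for $j=1,\dots,q$. (A4) For $j=1,\dots,q$ the random variables $\sup_{\theta\in\Theta_0}\frac{1}{P_\theta(B_n)}\int_{B_n}|\partial f_\theta(y)/\partial\theta_j|\,dy$, $n\ge2$,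 are uniformly integrable. Then, for $h=h_1$, for $h=h_2$, and for $h=h_5$ with any $\alpha\in(0,1)$, under A2, A3 and A4, and for $h=h_5$ with any $\alpha\in(1,2]$, under A2 and A3 alone, the expectations $\lambda_n(\theta)$, $n\ge 2$, and $\lambda(\theta)$ exist for every $\theta\in\Theta_0$, and $\lambda_n(\theta)\to\lambda(\theta)$ uniformly for $\theta\in\Theta_0$ as $n\to\infty$. -/

import Mathlib

open MeasureTheory ProbabilityTheory Filter Topology
open scoped ENNReal NNReal

noncomputable section

namespace GMSP

/-! ### The divergence functions -/

/-- `h₁(x) = ln x - x + 1`. -/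
def h1 (x : ℝ) : ℝ := Real.log x - x + 1

/-- `h₂(x) = (1 - x) ln x`. -/
def h2 (x : ℝ) : ℝ := (1 - x) * Real.log x

/-- `h₅(x) = sgn(1 - α) (x ^ α - α x + α - 1)`. -/
def h5 (α x : ℝ) : ℝ := Real.sign (1 - α) * (x ^ α - α * x + α - 1)

/-- `v(x) = h'(x) x`. -/
def v (h : ℝ → ℝ) (x : ℝ) : ℝ := deriv h x * x

/-! ### Densities and derivatives with respect to the parameter -/

variable {d q : ℕ}

/-- `p` is a probability density with respect to Lebesgue measure on `ℝᵈ`. -/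
structure IsDensity (p : EuclideanSpace ℝ (Fin d) → ℝ) : Prop where
  measurable : Measurable p
  nonneg : ∀ y, 0 ≤ p y
  lintegral_eq_one : ∫⁻ y, ENNReal.ofReal (p y) = 1

/-- The measure with density `p`; `law (f θ)` is `P_θ`. -/
def law (p : EuclideanSpace ℝ (Fin d) → ℝ) : Measure (EuclideanSpace ℝ (Fin d)) :=
  volume.withDensity fun y => ENNReal.ofReal (p y)

/-- The partial derivative `∂ f_θ(x) / ∂ θ_j`. -/
def pd (f : EuclideanSpace ℝ (Fin q) → EuclideanSpace ℝ (Fin d) → ℝ) (j : Fin q)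
    (θ : EuclideanSpace ℝ (Fin q)) (x : EuclideanSpace ℝ (Fin d)) : ℝ :=
  fderiv ℝ (fun t => f t x) θ (EuclideanSpace.single j 1)

/-- The vector `∇ f_θ(x)` of the partial derivatives with respect to `θ`. -/
def grad (f : EuclideanSpace ℝ (Fin q) → EuclideanSpace ℝ (Fin d) → ℝ)
    (θ : EuclideanSpace ℝ (Fin q)) (x : EuclideanSpace ℝ (Fin d)) : EuclideanSpace ℝ (Fin q) :=
  WithLp.toLp 2 fun j => pd f j θ x

/-- The second order partial derivative `∂² f_θ(x) / ∂ θ_j ∂ θ_l`. -/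
def pd2 (f : EuclideanSpace ℝ (Fin q) → EuclideanSpace ℝ (Fin d) → ℝ) (j l : Fin q)
    (θ : EuclideanSpace ℝ (Fin q)) (x : EuclideanSpace ℝ (Fin d)) : ℝ :=
  pd (pd f l) j θ x

/-! ### Nearest neighbour balls -/

/-- `R_n(i) = min_{j ≠ i} |x_i - x_j|` for the sample `x_0, …, x_{n-1}`
(a minimum over a non-empty finite set when `2 ≤ n`). -/
def nnRadius (x : ℕ → EuclideanSpace ℝ (Fin d)) (n i : ℕ) : ℝ :=
  ⨅ j : {j : ℕ // j < n ∧ j ≠ i}, dist (x i) (x j)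

/-- The nearest neighbour ball `B_n(x_i)`. -/
def nnBall (x : ℕ → EuclideanSpace ℝ (Fin d)) (n i : ℕ) : Set (EuclideanSpace ℝ (Fin d)) :=
  Metric.closedBall (x i) (nnRadius x n i)

/-! ### The functions `z_{i,n}`, `ψ_n`, `ψ` and their expectations -/

/-- `z_{i,n}(θ) = n P_θ(B_n(x_i))`. -/
def z (f : EuclideanSpace ℝ (Fin q) → EuclideanSpace ℝ (Fin d) → ℝ) (n i : ℕ)
    (x : ℕ → EuclideanSpace ℝ (Fin d)) (θ : EuclideanSpace ℝ (Fin q)) : ℝ :=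
  n * (law (f θ)).real (nnBall x n i)

/-- `ψ_n(x_i, θ) = v(z_{i,n}(θ)) P_θ(B_n(x_i))⁻¹ ∫_{B_n(x_i)} ∇ f_θ(y) dy`. -/
def psiN (h : ℝ → ℝ) (f : EuclideanSpace ℝ (Fin q) → EuclideanSpace ℝ (Fin d) → ℝ) (n i : ℕ)
    (x : ℕ → EuclideanSpace ℝ (Fin d)) (θ : EuclideanSpace ℝ (Fin q)) :
    EuclideanSpace ℝ (Fin q) :=
  (v h (z f n i x θ) * ((law (f θ)).real (nnBall x n i))⁻¹) • ∫ y in nnBall x n i, grad f θ y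

/-- `ψ(x, θ) = v(Z f_θ(x) / g(x)) ∇ f_θ(x) / f_θ(x)`, where `g = f_{θ₀}` and `Z = t`. -/
def psi (h : ℝ → ℝ) (f : EuclideanSpace ℝ (Fin q) → EuclideanSpace ℝ (Fin d) → ℝ)
    (θ₀ : EuclideanSpace ℝ (Fin q)) (x : EuclideanSpace ℝ (Fin d)) (t : ℝ)
    (θ : EuclideanSpace ℝ (Fin q)) : EuclideanSpace ℝ (Fin q) :=
  (v h (t * (f θ x / f θ₀ x)) * (f θ x)⁻¹) • grad f θ x

/-- `λ_n(θ) = E ψ_n(ξ, θ)`, with `ξ` the first observation (the observations are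
exchangeable, so that the choice does not matter). -/
def lamN {Ω : Type*} [MeasurableSpace Ω] (μ : Measure Ω)
    (ξ : ℕ → Ω → EuclideanSpace ℝ (Fin d)) (h : ℝ → ℝ)
    (f : EuclideanSpace ℝ (Fin q) → EuclideanSpace ℝ (Fin d) → ℝ) (n : ℕ)
    (θ : EuclideanSpace ℝ (Fin q)) : EuclideanSpace ℝ (Fin q) :=
  ∫ ω, psiN h f n 0 (fun i => ξ i ω) θ ∂μ

/-- The joint law of `(ξ, Z)`: `ξ` has density `g = f_{θ₀}`, `Z` is standard exponential, and
the two are independent. -/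
def limitLaw (f : EuclideanSpace ℝ (Fin q) → EuclideanSpace ℝ (Fin d) → ℝ)
    (θ₀ : EuclideanSpace ℝ (Fin q)) : Measure (EuclideanSpace ℝ (Fin d) × ℝ) :=
  (law (f θ₀)).prod (expMeasure 1)

/-- `λ(θ) = E ψ(ξ, θ)`. -/
def lam (h : ℝ → ℝ) (f : EuclideanSpace ℝ (Fin q) → EuclideanSpace ℝ (Fin d) → ℝ)
    (θ₀ θ : EuclideanSpace ℝ (Fin q)) : EuclideanSpace ℝ (Fin q) :=
  ∫ p, psi h f θ₀ p.1 p.2 θ ∂(limitLaw f θ₀)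

/-! ### Assumptions -/

/-- `f_θ(x)` is twice continuously differentiable in `θ` at the points of `Θ₀`, and `f_θ(x)` and
its first and second order partial derivatives are continuous in `(θ, x)`, `θ ∈ Θ₀`, `x ∈ ℝᵈ`. -/
structure SmoothFamily (f : EuclideanSpace ℝ (Fin q) → EuclideanSpace ℝ (Fin d) → ℝ)
    (Θ₀ : Set (EuclideanSpace ℝ (Fin q))) : Prop where
  contDiffAt : ∀ x, ∀ θ ∈ Θ₀, ContDiffAt ℝ 2 (fun t => f t x) θ
  continuousOn : ContinuousOn (fun p : _ × _ => f p.1 p.2) (Θ₀ ×ˢ Set.univ)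
  continuousOn_pd : ∀ j, ContinuousOn (fun p : _ × _ => pd f j p.1 p.2) (Θ₀ ×ˢ Set.univ)
  continuousOn_pd2 : ∀ j l, ContinuousOn (fun p : _ × _ => pd2 f j l p.1 p.2) (Θ₀ ×ˢ Set.univ)

/-- `E [sup_{Θ₀} |∂ f_θ(ξ) / g(ξ)|²] < ∞` for every first order partial derivative, where `ξ` has
density `g = f_{θ₀}`. -/
def SquareIntegrableSup (f : EuclideanSpace ℝ (Fin q) → EuclideanSpace ℝ (Fin d) → ℝ)
    (θ₀ : EuclideanSpace ℝ (Fin q)) (Θ₀ : Set (EuclideanSpace ℝ (Fin q))) : Prop :=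
  ∀ j, ∫⁻ x, ⨆ θ ∈ Θ₀, ‖pd f j θ x / f θ₀ x‖ₑ ^ 2 ∂(law (f θ₀)) < ∞

/-- Uniform integrability of the `[0, ∞]`-valued random variables `X n`, `n ≥ 2`:
`sup_n E [X n ; X n ≥ C] → 0` as `C → ∞`. -/
def UnifInt {Ω : Type*} [MeasurableSpace Ω] (μ : Measure Ω) (X : ℕ → Ω → ℝ≥0∞) : Prop :=
  ∀ ε : ℝ≥0∞, 0 < ε → ∃ C : ℝ≥0, ∀ n, 2 ≤ n →
    ∫⁻ ω in {ω | (C : ℝ≥0∞) ≤ X n ω}, X n ω ∂μ ≤ ε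

/-- The random variables `sup_{Θ₀} P_θ(B_n(ξ))⁻¹ ∫_{B_n(ξ)} |∂ f_θ(y)| dy`, `n ≥ 2`, are uniformly
integrable, for every first order partial derivative. -/
def UnifIntScore {Ω : Type*} [MeasurableSpace Ω] (μ : Measure Ω)
    (ξ : ℕ → Ω → EuclideanSpace ℝ (Fin d))
    (f : EuclideanSpace ℝ (Fin q) → EuclideanSpace ℝ (Fin d) → ℝ)
    (Θ₀ : Set (EuclideanSpace ℝ (Fin q))) : Prop :=
  ∀ j, UnifInt μ fun n ω => ⨆ θ ∈ Θ₀,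
    (∫⁻ y in nnBall (fun i => ξ i ω) n 0, ‖pd f j θ y‖ₑ) /
      law (f θ) (nnBall (fun i => ξ i ω) n 0)

/-! ### The conclusion -/

/-- For `θ ∈ Θ₀` the expectations `λ_n(θ)`, `n ≥ 2`, and `λ(θ)` exist, and
`λ_n(θ) → λ(θ)` uniformly for `θ ∈ Θ₀` as `n → ∞`. -/
def LamConvergesUniformly {Ω : Type*} [MeasurableSpace Ω] (μ : Measure Ω)
    (ξ : ℕ → Ω → EuclideanSpace ℝ (Fin d)) (h : ℝ → ℝ)
    (f : EuclideanSpace ℝ (Fin q) → EuclideanSpace ℝ (Fin d) → ℝ)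
    (θ₀ : EuclideanSpace ℝ (Fin q)) (Θ₀ : Set (EuclideanSpace ℝ (Fin q))) : Prop :=
  (∀ n, 2 ≤ n → ∀ θ ∈ Θ₀, Integrable (fun ω => psiN h f n 0 (fun i => ξ i ω) θ) μ) ∧
  (∀ θ ∈ Θ₀, Integrable (fun p => psi h f θ₀ p.1 p.2 θ) (limitLaw f θ₀)) ∧
  TendstoUniformlyOn (fun n θ => lamN μ ξ h f n θ) (fun θ => lam h f θ₀ θ) atTop Θ₀

end GMSP

end

/-! The sample is replaced by a coupling. Given `ξ = x`, the nearest neighbour distance exceeds `r`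
with probability `(1 - P(B(x,r)))^(n-1)`, where `P` is the true law. If `t` is standard exponential,
a radius `ρ` with `P(B(x,ρ)) = 1 - exp(-t/(n-1))` has the same tail, so `(ξ, R_n)` can be replaced
by `(x, ρ)` for all `n` on a single probability space (`map_nnRadius_eq`). There `n P(B) → t` and `ρ
→ 0`, so continuity of the densities and gradients gives `ψ_n → ψ` almost surely, even along
parameters `θ_k → θ` (`tendsto_ballPsi`). On a compact set, convergence along all such sequences is
uniform convergence. What remains is to exchange limit and expectation.

For this, `|v(z)| ≤ C (c₀ + z + z²)` splits `ψ_n`. The term with `c₀` is controlled by the score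
`∫_B |∇f_θ| / P_θ(B)`, which is uniformly integrable by `UnifIntScore`. For the others let `G = sup
|∇f_θ / g|`. Then `∫_B |∇f_θ| ≤ ∫_B G dP`, and the mean value inequality gives `P_θ(B) ≤ ∫_B (1 + D
G) dP`, with `D` a bound for `|θ - θ₀|` on `Θ₀`. Since `n P(B) ≤ 2t`, these terms are at most a
constant times `(1 + 2t)²` times the average of `(1 + G)²` over `B`. The function `(1 + G)²` is
integrable by `SquareIntegrableSup`. Averaging over the coupling balls is bounded on `L¹(P)`,
uniformly in `n` and `t`: by Besicovitch's theorem, the balls of mass `u` that contain a given point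
have centres in a set of mass at most `N u`. Truncation then makes the averages uniformly integrable
(`exists_couplingAverage_dominated`).

The pointwise limit is delicate only where `f_θ(x) = 0 < g(x)`. If `c₀ = 0`, then `v(z)/z` stays
bounded near `0` while the gradient vanishes, so `ψ_n → 0`. If `c₀ ≠ 0`, uniform integrability of
the scores excludes the case almost surely: by Fatou the scores stay below some `c` for infinitely
many `n`, and a Gronwall argument on the segment from `θ₀` to `θ` yields `g(x) ≤ exp(D c) f_θ(x)`.
The function `h₅` with `α ∈ (1, 2]` admits `c₀ = 0` and so needs no assumption on the scores. -/

namespace GMSP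

/-! ### Convergence of integrals under uniform integrability -/

/-- A form of Vitali's theorem: almost everywhere convergence and domination up to an error that is
uniformly small in mean give convergence of the integrals. -/
theorem tendsto_integral_of_dominated_up_to {X F : Type*} [MeasurableSpace X]
    [NormedAddCommGroup F] [NormedSpace ℝ F] {m : Measure X} {u : ℕ → X → F} {w : X → F}
    (hu : ∀ k, AEStronglyMeasurable (u k) m)
    (hlim : ∀ᵐ x ∂m, Tendsto (fun k => u k x) atTop (𝓝 (w x)))
    (hdom : ∀ ε : ℝ≥0∞, 0 < ε → ∃ (a : X → ℝ≥0∞) (b : ℕ → X → ℝ≥0∞), AEMeasurable a m ∧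
      ∫⁻ x, a x ∂m < ∞ ∧ (∀ k, ∫⁻ x, b k x ∂m ≤ ε) ∧ ∀ k, ∀ᵐ x ∂m, ‖u k x‖ₑ ≤ a x + b k x) :
    Integrable w m ∧ Tendsto (fun k => ∫ x, u k x ∂m) atTop (𝓝 (∫ x, w x ∂m)) := by
  have hw : AEStronglyMeasurable w m := aestronglyMeasurable_of_tendsto_ae _ hu hlim
  have hbd : ∀ (a : X → ℝ≥0∞) (b : ℕ → X → ℝ≥0∞) (ε : ℝ≥0∞), AEMeasurable a m →
      (∀ k, ∫⁻ x, b k x ∂m ≤ ε) → (∀ k, ∀ᵐ x ∂m, ‖u k x‖ₑ ≤ a x + b k x) →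
      ∀ k, ∫⁻ x, ‖u k x‖ₑ ∂m ≤ ∫⁻ x, a x ∂m + ε := by
    intro a b ε ha hb hab k
    calc ∫⁻ x, ‖u k x‖ₑ ∂m ≤ ∫⁻ x, a x + b k x ∂m := lintegral_mono_ae (hab k)
      _ = ∫⁻ x, a x ∂m + ∫⁻ x, b k x ∂m := lintegral_add_left' ha _
      _ ≤ _ := by gcongr; exact hb k
  have hui : ∀ k, Integrable (u k) m := by
    intro k
    obtain ⟨a, b, ha, hai, hb, hab⟩ := hdom 1 one_pos
    exact ⟨hu k, (hbd a b 1 ha hb hab k).trans_lt (by finiteness)⟩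
  have hwi : Integrable w m := by
    obtain ⟨a, b, ha, hai, hb, hab⟩ := hdom 1 one_pos
    refine ⟨hw, ?_⟩
    calc ∫⁻ x, ‖w x‖ₑ ∂m = ∫⁻ x, liminf (fun k => ‖u k x‖ₑ) atTop ∂m := by
          refine lintegral_congr_ae ?_
          filter_upwards [hlim] with x hx
          exact ((continuous_enorm.tendsto _).comp hx).liminf_eq.symm
      _ ≤ liminf (fun k => ∫⁻ x, ‖u k x‖ₑ ∂m) atTop := lintegral_liminf_le' fun k => (hu k).enorm
      _ ≤ ∫⁻ x, a x ∂m + 1 := by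
          refine (liminf_le_liminf (Eventually.of_forall (hbd a b 1 ha hb hab))).trans ?_
          simp
      _ < ∞ := by finiteness
  refine ⟨hwi, tendsto_integral_of_L1 w hwi.1 (Eventually.of_forall hui) ?_⟩
  rw [ENNReal.tendsto_nhds_zero]
  intro ε hε
  obtain ⟨δ, hδ, hδε⟩ : ∃ δ : ℝ≥0∞, 0 < δ ∧ δ + δ ≤ ε :=
    ⟨ε / 2, ENNReal.half_pos hε.ne', (ENNReal.add_halves ε).le⟩
  obtain ⟨a, b, ha, hai, hb, hab⟩ := hdom δ hδ
  -- The minimum is dominated by an integrable function, so it tends to `0` in mean; the full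
  -- difference exceeds it by at most `b k`. Keeping `b k` as the second summand below avoids any
  -- measurability of `b`.
  have hmin : Tendsto (fun k => ∫⁻ x, min ‖u k x - w x‖ₑ (a x + ‖w x‖ₑ) ∂m) atTop (𝓝 0) := by
    have := tendsto_lintegral_of_dominated_convergence' (μ := m)
      (F := fun k x => min ‖u k x - w x‖ₑ (a x + ‖w x‖ₑ)) (f := fun _ => 0)
      (fun x => a x + ‖w x‖ₑ) (fun k => ((hu k).sub hw).enorm.min (ha.add hw.enorm))
      (fun k => Eventually.of_forall fun x => min_le_right _ _) (by
        rw [lintegral_add_left' ha]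
        exact ENNReal.add_ne_top.2 ⟨hai.ne, hwi.2.ne⟩) (by
        filter_upwards [hlim] with x hx
        have h0 : Tendsto (fun k => ‖u k x - w x‖ₑ) atTop (𝓝 0) := by
          have := (continuous_enorm.tendsto _).comp (hx.sub_const (w x))
          simpa [Function.comp_def] using this
        exact tendsto_of_tendsto_of_tendsto_of_le_of_le tendsto_const_nhds h0
          (fun _ => zero_le) (fun _ => min_le_left _ _))
    simpa using this
  filter_upwards [(ENNReal.tendsto_nhds_zero.1 hmin) δ hδ] with k hk
  calc ∫⁻ x, ‖u k x - w x‖ₑ ∂m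
      ≤ ∫⁻ x, min ‖u k x - w x‖ₑ (a x + ‖w x‖ₑ) + b k x ∂m := by
        refine lintegral_mono_ae ?_
        filter_upwards [hab k] with x hx
        rw [min_add]
        refine le_min le_self_add ?_
        calc ‖u k x - w x‖ₑ ≤ ‖u k x‖ₑ + ‖w x‖ₑ := enorm_sub_le
          _ ≤ a x + b k x + ‖w x‖ₑ := by gcongr
          _ = _ := by ring
    _ = ∫⁻ x, min ‖u k x - w x‖ₑ (a x + ‖w x‖ₑ) ∂m + ∫⁻ x, b k x ∂m :=
        lintegral_add_left' (((hu k).sub hw).enorm.min (ha.add hw.enorm)) _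
    _ ≤ δ + δ := by gcongr; exact hb k
    _ ≤ ε := hδε

/-- Uniform convergence on a compact set follows from convergence along sequences of arguments. -/
theorem tendstoUniformlyOn_of_seq {T F : Type*} [PseudoMetricSpace T]
    [PseudoMetricSpace F] {u : ℕ → T → F} {w : T → F} {K : Set T} (hK : IsCompact K)
    (h : ∀ (n : ℕ → ℕ) (s : ℕ → T) (t : T), Tendsto n atTop atTop → (∀ k, s k ∈ K) → t ∈ K →
      Tendsto s atTop (𝓝 t) → Tendsto (fun k => u (n k) (s k)) atTop (𝓝 (w t))) :
    TendstoUniformlyOn u w atTop K := by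
  have hloc : ∀ t ∈ K, Tendsto (fun p : ℕ × T => u p.1 p.2) (atTop ×ˢ 𝓝[K] t) (𝓝 (w t)) := by
    intro t ht
    refine tendsto_of_seq_tendsto fun x hx => ?_
    have h1 : Tendsto (fun k => (x k).1) atTop atTop := tendsto_fst.comp hx
    have h2 : Tendsto (fun k => (x k).2) atTop (𝓝[K] t) := tendsto_snd.comp hx
    have h3 := tendsto_nhdsWithin_iff.1 h2
    obtain ⟨N, hN⟩ := eventually_atTop.1 h3.2
    have := h (fun k => (x (k + N)).1) (fun k => (x (k + N)).2) t
      (h1.comp (tendsto_add_atTop_nat N)) (fun k => hN _ (by omega)) ht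
      (h3.1.comp (tendsto_add_atTop_nat N))
    exact (tendsto_add_atTop_iff_nat N).1 this
  have hpt : ∀ t ∈ K, Tendsto (fun n => u n t) atTop (𝓝 (w t)) := fun t ht =>
    h (fun n => n) (fun _ => t) t tendsto_id (fun _ => ht) ht tendsto_const_nhds
  -- The joint limit controls `u n s` for large `n` and `s` near `t`. Letting `n → ∞` with `s` fixed
  -- makes `w` continuous, without any continuity of the `u n`.
  have hcont : ContinuousOn w K := by
    intro t ht
    rw [ContinuousWithinAt, Metric.tendsto_nhds]
    intro ε hε
    have h1 := (hloc t ht).eventually (Metric.closedBall_mem_nhds (w t) (half_pos hε))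
    obtain ⟨pa, hpa, pb, hpb, hp⟩ := eventually_prod_iff.1 h1
    filter_upwards [hpb, self_mem_nhdsWithin] with s hs hsK
    have : dist (w s) (w t) ≤ ε / 2 := by
      refine le_of_tendsto ((hpt s hsK).dist tendsto_const_nhds) ?_
      filter_upwards [hpa] with n hn using hp hn hs
    linarith
  rw [← tendstoLocallyUniformlyOn_iff_tendstoUniformlyOn_of_compact hK,
    tendstoLocallyUniformlyOn_iff_filter]
  intro t ht
  rw [tendstoUniformlyOnFilter_iff_tendsto]
  refine Tendsto.mono_right ?_ (nhds_le_uniformity (w t))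
  rw [nhds_prod_eq]
  exact (Tendsto.comp (hcont t ht) tendsto_snd).prodMk (hloc t ht)

end GMSP

namespace GMSP

/-! ### Masses of balls as functions of the radius -/

theorem monotone_real_closedBall {E : Type*} [PseudoMetricSpace E] [MeasurableSpace E]
    {P : Measure E} [IsProbabilityMeasure P] (x : E) :
    Monotone fun r => P.real (Metric.closedBall x r) :=
  fun _ _ h => measureReal_mono (Metric.closedBall_subset_closedBall h)

section Radius

variable {E : Type*} [PseudoMetricSpace E] [SecondCountableTopology E] [MeasurableSpace E]
  [BorelSpace E]
  {P : Measure E} [IsProbabilityMeasure P]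

/-- Gives access to monotonicity, right continuity and the limit at infinity of distribution
functions. -/
theorem real_closedBall_eq_cdf (x : E) (r : ℝ) :
    P.real (Metric.closedBall x r) = cdf (P.map fun y => dist y x) r := by
  have hm : Measurable fun y : E => dist y x := measurable_id.dist measurable_const
  have : IsProbabilityMeasure (P.map fun y => dist y x) :=
    Measure.isProbabilityMeasure_map hm.aemeasurable
  rw [cdf_eq_real, Measure.real, Measure.real, Measure.map_apply hm measurableSet_Iic]
  rfl

/-- The distribution function of the distance to `x` jumps only at atoms, and its atoms are spheres
of positive mass. -/
theorem continuous_real_closedBall (hP : ∀ (x : E) r, P (Metric.sphere x r) = 0) (x : E) :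
    Continuous fun r => P.real (Metric.closedBall x r) := by
  have hm : Measurable fun y : E => dist y x := measurable_id.dist measurable_const
  have : IsProbabilityMeasure (P.map fun y => dist y x) :=
    Measure.isProbabilityMeasure_map hm.aemeasurable
  simp_rw [real_closedBall_eq_cdf]
  rw [continuous_iff_continuousAt]
  intro r
  have h0 : (cdf (P.map fun y => dist y x)).measure {r} = 0 := by
    rw [measure_cdf, Measure.map_apply hm (measurableSet_singleton r)]
    exact hP x r
  rw [StieltjesFunction.measure_singleton, ENNReal.ofReal_eq_zero] at h0
  rw [(monotone_cdf _).continuousAt_iff_leftLim_eq_rightLim, StieltjesFunction.rightLim_eq]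
  exact le_antisymm ((monotone_cdf _).leftLim_le le_rfl) (by linarith)

theorem measurable_measure_closedBall (Q : Measure E) [SFinite Q] :
    Measurable fun p : E × ℝ => Q (Metric.closedBall p.1 p.2) := by
  have : MeasurableSet {p : (E × ℝ) × E | dist p.2 p.1.1 ≤ p.1.2} :=
    measurableSet_le (by fun_prop) (by fun_prop)
  exact measurable_measure_prodMk_left this

/-- For `t > 0` the smallest radius `r` with `P (closedBall x r) ≥ 1 - exp (- t / (n - 1))`. If `x`
has law `P` and `t` is standard exponential, this has the law of the nearest neighbour distance. -/
noncomputable def couplingRadius (P : Measure E) (n : ℕ) (p : E × ℝ) : ℝ :=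
  if 0 < p.2 then
    sInf {r | 1 - Real.exp (-(p.2 / ((n : ℝ) - 1))) ≤ P.real (Metric.closedBall p.1 r)}
  else 0

/-- By continuity of the mass in the radius the infimum is attained, so the radius is a quantile
function; this equivalence is its Galois property. The level lies strictly between `0` and `1`, so
the set of admissible radii is non-empty and bounded below by `0`. -/
theorem couplingRadius_le_iff (hP : ∀ (x : E) r, P (Metric.sphere x r) = 0) {n : ℕ} (hn : 2 ≤ n)
    {x : E} {t : ℝ} (ht : 0 < t) (r : ℝ) :
    couplingRadius P n (x, t) ≤ r ↔
      1 - Real.exp (-(t / ((n : ℝ) - 1))) ≤ P.real (Metric.closedBall x r) := by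
  have hn' : (0 : ℝ) < n - 1 := by
    have : (2 : ℝ) ≤ n := by exact_mod_cast hn
    linarith
  set u := 1 - Real.exp (-(t / ((n : ℝ) - 1))) with hu
  have hu0 : 0 < u := by
    have : Real.exp (-(t / ((n : ℝ) - 1))) < 1 := Real.exp_lt_one_iff.2 (by
      have := div_pos ht hn'
      linarith)
    linarith
  have hu1 : u < 1 := by
    have := Real.exp_pos (-(t / ((n : ℝ) - 1)))
    linarith
  set s := {r | u ≤ P.real (Metric.closedBall x r)} with hs
  have hclosed : IsClosed s := isClosed_le continuous_const (continuous_real_closedBall hP x)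
  have hne : s.Nonempty := by
    have := (tendsto_cdf_atTop (P.map fun y => dist y x)).eventually (lt_mem_nhds hu1)
    obtain ⟨r, hr⟩ := this.exists
    exact ⟨r, by rw [hs, Set.mem_ofPred_eq, real_closedBall_eq_cdf]; exact hr.le⟩
  have hbdd : BddBelow s := by
    refine ⟨0, fun r hr => ?_⟩
    by_contra! h
    rw [hs, Set.mem_ofPred_eq, Metric.closedBall_eq_empty.2 h] at hr
    simp at hr
    linarith
  have hmem : sInf s ∈ s := hclosed.csInf_mem hne hbdd
  have hdef : couplingRadius P n (x, t) = sInf s := by simp [couplingRadius, ht, hs, hu]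
  rw [hdef]
  exact ⟨fun h => hmem.trans (monotone_real_closedBall x h), fun h => csInf_le hbdd h⟩

theorem real_closedBall_couplingRadius (hP : ∀ (x : E) r, P (Metric.sphere x r) = 0) {n : ℕ}
    (hn : 2 ≤ n) {x : E} {t : ℝ} (ht : 0 < t) :
    P.real (Metric.closedBall x (couplingRadius P n (x, t))) =
      1 - Real.exp (-(t / ((n : ℝ) - 1))) := by
  have hle := couplingRadius_le_iff hP hn (x := x) ht
  refine le_antisymm ?_ ((hle _).1 le_rfl)
  have hu1 : 1 - Real.exp (-(t / ((n : ℝ) - 1))) < 1 := by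
    have := Real.exp_pos (-(t / ((n : ℝ) - 1)))
    linarith
  obtain ⟨b, hb⟩ := ((tendsto_cdf_atTop (P.map fun y => dist y x)).eventually
    (lt_mem_nhds hu1)).exists
  rw [← real_closedBall_eq_cdf] at hb
  -- A negative radius gives the empty ball, the lower end for the intermediate value theorem.
  have h0 : P.real (Metric.closedBall x (-1)) ≤ 1 - Real.exp (-(t / ((n : ℝ) - 1))) := by
    rw [Metric.closedBall_eq_empty.2 (by norm_num)]
    have hn' : (0 : ℝ) < n - 1 := by
      have : (2 : ℝ) ≤ n := by exact_mod_cast hn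
      linarith
    have : Real.exp (-(t / ((n : ℝ) - 1))) ≤ 1 := Real.exp_le_one_iff.2 (by
      have := div_pos ht hn'
      linarith)
    simpa using this
  obtain ⟨r, hr⟩ := mem_range_of_exists_le_of_exists_ge (continuous_real_closedBall hP x)
    ⟨_, h0⟩ ⟨b, hb.le⟩
  calc _ ≤ P.real (Metric.closedBall x r) := monotone_real_closedBall x ((hle r).2 hr.ge)
    _ = _ := hr

theorem measurable_couplingRadius (hP : ∀ (x : E) r, P (Metric.sphere x r) = 0) {n : ℕ}
    (hn : 2 ≤ n) : Measurable (couplingRadius P n) := by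
  refine measurable_of_Iic fun r => ?_
  have : couplingRadius P n ⁻¹' Set.Iic r =
      ({p | 0 < p.2} ∩ {p | 1 - Real.exp (-(p.2 / ((n : ℝ) - 1))) ≤
        P.real (Metric.closedBall p.1 r)}) ∪ ({p | p.2 ≤ 0} ∩ {_p | 0 ≤ r}) := by
    ext ⟨x, t⟩
    by_cases ht : 0 < t
    · simp [ht, couplingRadius_le_iff hP hn ht]
    · simp [ht, couplingRadius, not_lt.1 ht]
  rw [this]
  have h1 : Measurable fun p : E × ℝ => P.real (Metric.closedBall p.1 r) :=
    ((measurable_measure_closedBall P).comp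
      (measurable_fst.prodMk measurable_const)).ennreal_toReal
  refine ((measurableSet_lt measurable_const measurable_snd).inter
    (measurableSet_le (by fun_prop) h1)).union
    ((measurableSet_le measurable_snd measurable_const).inter (MeasurableSet.const _))

end Radius

/-! ### Points that lie in many balls of the same mass -/

/-- A consequence of the Besicovitch covering theorem: if all the balls `closedBall x (ρ x)` have
mass at most `u`, then those that contain a given point have centres in a set of mass at most
`N u`, with `N` depending on the space only. -/
theorem exists_measure_mem_closedBall_le (E : Type*) [MetricSpace E] [SecondCountableTopology E]
    [HasBesicovitchCovering E] [MeasurableSpace E] [OpensMeasurableSpace E] :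
    ∃ N : ℕ, ∀ (P : Measure E) (ρ : E → ℝ) (u : ℝ≥0∞) (y : E), (∀ x, 0 < ρ x) →
      (∀ x, P (Metric.closedBall x (ρ x)) ≤ u) →
      P {x | y ∈ Metric.closedBall x (ρ x)} ≤ N * u := by
  obtain ⟨N, τ, hτ, hN⟩ := HasBesicovitchCovering.no_satelliteConfig (α := E)
  refine ⟨N, fun P ρ u y hρ hu => ?_⟩
  -- The covering theorem needs bounded radii; the bound is removed at the end by monotone
  -- exhaustion.
  have hR : ∀ R : ℕ, P {x | y ∈ Metric.closedBall x (ρ x) ∧ ρ x ≤ R} ≤ N * u := by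
    intro R
    let q : Besicovitch.BallPackage {x | y ∈ Metric.closedBall x (ρ x) ∧ ρ x ≤ R} E :=
      { c := fun x => x, r := fun x => ρ x, rpos := fun x => hρ x, r_bound := R
        r_le := fun x => x.2.2 }
    obtain ⟨s, hs, hcov⟩ := Besicovitch.exist_disjoint_covering_families hτ hN q
    -- All these balls contain `y`, so a disjoint family has at most one member and the `N` families
    -- cover by at most `N` balls.
    have hsub : ∀ i, (s i).Subsingleton := by
      intro i a ha b hb
      by_contra hab
      exact Set.disjoint_left.1 (hs i ha hb hab) a.2.1 b.2.1
    calc P {x | y ∈ Metric.closedBall x (ρ x) ∧ ρ x ≤ R}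
        ≤ P (⋃ i : Fin N, ⋃ j ∈ s i, Metric.ball (q.c j) (q.r j)) := by
          refine measure_mono fun x hx => hcov ⟨⟨x, hx⟩, rfl⟩
      _ ≤ ∑ i : Fin N, P (⋃ j ∈ s i, Metric.ball (q.c j) (q.r j)) := measure_iUnion_fintype_le _ _
      _ ≤ ∑ _i : Fin N, u := by
          refine Finset.sum_le_sum fun i _ => ?_
          rcases (hsub i).eq_empty_or_singleton with h | ⟨a, h⟩
          · simp [h]
          · rw [h, Set.biUnion_singleton]
            exact (measure_mono Metric.ball_subset_closedBall).trans (hu _)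
      _ = N * u := by simp
  have hun : {x | y ∈ Metric.closedBall x (ρ x)} =
      ⋃ R : ℕ, {x | y ∈ Metric.closedBall x (ρ x) ∧ ρ x ≤ R} := by
    ext x
    simp only [Set.mem_ofPred_eq, Set.mem_iUnion, exists_and_left]
    exact ⟨fun h => ⟨h, exists_nat_ge _⟩, fun h => h.1⟩
  rw [hun, Monotone.measure_iUnion]
  · exact iSup_le hR
  · intro a b hab x hx
    exact ⟨hx.1, hx.2.trans (by exact_mod_cast hab)⟩

end GMSP

namespace GMSP

/-! ### The law of the nearest neighbour distance -/

theorem expMeasure_one_Ioi {a : ℝ} (ha : 0 ≤ a) :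
    expMeasure 1 (Set.Ioi a) = ENNReal.ofReal (Real.exp (-a)) := by
  have := isProbabilityMeasure_expMeasure one_pos
  have h1 : (expMeasure 1).real (Set.Iic a) = 1 - Real.exp (-a) := by
    rw [← cdf_eq_real, cdf_expMeasure_eq one_pos]
    simp [ha]
  rw [← ofReal_measureReal, ← Set.compl_Iic, probReal_compl_eq_one_sub measurableSet_Iic, h1]
  simp

theorem ae_pos_expMeasure : ∀ᵐ t ∂expMeasure 1, 0 < t := by
  have := isProbabilityMeasure_expMeasure one_pos
  have h := expMeasure_one_Ioi le_rfl
  rw [neg_zero, Real.exp_zero, ENNReal.ofReal_one] at h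
  exact (prob_compl_eq_zero_iff measurableSet_Ioi).2 h

section Law

variable {d : ℕ} {P : Measure (EuclideanSpace ℝ (Fin d))} [IsProbabilityMeasure P]

/-- With `F` the mass of the ball, the radius exceeds `r` exactly when `t > -(n-1) log (1 - F)`, an
event of exponential probability `(1 - F)^(n-1)`. -/
theorem expMeasure_lt_couplingRadius (hP : ∀ (x : EuclideanSpace ℝ (Fin d)) r,
    P (Metric.sphere x r) = 0) {n : ℕ} (hn : 2 ≤ n) (x : EuclideanSpace ℝ (Fin d)) (r : ℝ) :
    expMeasure 1 {t | r < couplingRadius P n (x, t)} =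
      P (Metric.closedBall x r)ᶜ ^ (n - 1) := by
  have hn' : (0 : ℝ) < n - 1 := by
    have : (2 : ℝ) ≤ n := by exact_mod_cast hn
    linarith
  have hc : P (Metric.closedBall x r)ᶜ = ENNReal.ofReal (1 - P.real (Metric.closedBall x r)) := by
    rw [← probReal_compl_eq_one_sub Metric.isClosed_closedBall.measurableSet, ofReal_measureReal]
  rw [hc]
  set F := P.real (Metric.closedBall x r) with hF
  have hF1 : F ≤ 1 := measureReal_le_one
  have hF0 : 0 ≤ F := measureReal_nonneg
  have hset : {t | r < couplingRadius P n (x, t)} =ᵐ[expMeasure 1]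
      {t | Real.exp (-(t / ((n : ℝ) - 1))) < 1 - F} := by
    filter_upwards [ae_pos_expMeasure] with t ht
    refine propext ?_
    change r < couplingRadius P n (x, t) ↔ Real.exp (-(t / ((n : ℝ) - 1))) < 1 - F
    rw [← not_le, couplingRadius_le_iff hP hn ht, not_le]
    constructor <;> intro h <;> linarith
  rw [measure_congr hset]
  rcases hF1.eq_or_lt with h1 | h1
  -- For `F = 1` the logarithm is meaningless, but both sides vanish because `n - 1 ≥ 1`.
  · have : {t : ℝ | Real.exp (-(t / ((n : ℝ) - 1))) < 1 - F} = ∅ := by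
      ext t
      simp only [h1, sub_self, Set.mem_ofPred_eq, Set.mem_empty_iff_false, iff_false, not_lt]
      positivity
    rw [this, h1]
    simp [show n - 1 ≠ 0 by omega]
  · have : {t : ℝ | Real.exp (-(t / ((n : ℝ) - 1))) < 1 - F} =
        Set.Ioi (-((n - 1) * Real.log (1 - F))) := by
      ext t
      rw [Set.mem_ofPred_eq, Set.mem_Ioi, ← Real.lt_log_iff_exp_lt (by linarith), neg_lt,
        lt_div_iff₀ hn', neg_mul, mul_comm]
    rw [this, expMeasure_one_Ioi, neg_neg, ← ENNReal.ofReal_pow (by linarith)]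
    · congr 1
      have : ((n : ℝ) - 1) = ((n - 1 : ℕ) : ℝ) := by
        rw [Nat.cast_sub (by omega)]
        simp
      rw [this, Real.exp_nat_mul, Real.exp_log (by linarith)]
    · have := Real.log_nonpos (x := 1 - F) (by linarith) (by linarith)
      nlinarith

variable {Ω : Type*} [MeasurableSpace Ω] {μ : Measure Ω} [IsProbabilityMeasure μ]
  {ξ : ℕ → Ω → EuclideanSpace ℝ (Fin d)}

theorem lt_nnRadius_iff {x : ℕ → EuclideanSpace ℝ (Fin d)} {n : ℕ} (hn : 2 ≤ n) (r : ℝ) :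
    r < nnRadius x n 0 ↔ ∀ j, j < n → j ≠ 0 → r < dist (x 0) (x j) := by
  have hne : Nonempty {j : ℕ // j < n ∧ j ≠ 0} := ⟨⟨1, by omega, by omega⟩⟩
  have hfin : Finite {j : ℕ // j < n ∧ j ≠ 0} :=
    Set.Finite.to_subtype ((Set.finite_Iio n).subset fun j hj => hj.1)
  constructor
  · intro h j hj hj0
    exact h.trans_le (ciInf_le (Set.finite_range _).bddBelow
      (⟨j, hj, hj0⟩ : {j : ℕ // j < n ∧ j ≠ 0}))
  · intro h
    obtain ⟨j, hj⟩ := exists_eq_ciInf_of_finite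
      (f := fun j : {j : ℕ // j < n ∧ j ≠ 0} => dist (x 0) (x j))
    rw [nnRadius, ← hj]
    exact h j j.2.1 j.2.2

theorem measurable_nnRadius (hmeas : ∀ i, Measurable (ξ i)) (n : ℕ) :
    Measurable fun ω => nnRadius (fun i => ξ i ω) n 0 := by
  unfold nnRadius
  exact Measurable.iInf fun j => (hmeas 0).dist (hmeas j)

/-- Given `ξ 0 = x`, the other `n - 1` independent points must all fall outside the closed ball;
Fubini integrates over `x`. -/
theorem measure_lt_nnRadius (hmeas : ∀ i, Measurable (ξ i)) (hindep : iIndepFun ξ μ)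
    (hlaw : ∀ i, μ.map (ξ i) = P) {n : ℕ} (hn : 2 ≤ n) {A : Set (EuclideanSpace ℝ (Fin d))}
    (hA : MeasurableSet A) (r : ℝ) :
    μ {ω | ξ 0 ω ∈ A ∧ r < nnRadius (fun i => ξ i ω) n 0} =
      ∫⁻ x in A, P (Metric.closedBall x r)ᶜ ^ (n - 1) ∂P := by
  let T : Finset ℕ := (Finset.range n).erase 0
  have hTcard : Fintype.card T = n - 1 := by
    simp [T, Finset.card_erase_of_mem, show 0 < n by omega]
  have hpair : IndepFun (ξ 0) (fun ω (i : T) => ξ i ω) μ := by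
    have h := hindep.indepFun_finset {0} T (by simp [T]) hmeas
    exact h.comp (φ := fun g => g ⟨0, Finset.mem_singleton_self 0⟩) (ψ := id)
      (measurable_pi_apply (X := fun _ : ({0} : Finset ℕ) => EuclideanSpace ℝ (Fin d)) _)
      measurable_id
  have hTm : Measurable fun ω (i : T) => ξ i ω := measurable_pi_lambda _ fun i => hmeas i
  have htuple : μ.map (fun ω (i : T) => ξ i ω) = Measure.pi fun _ => P := by
    have h := hindep.precomp (g := fun i : T => (i : ℕ)) Subtype.val_injective
    rw [iIndepFun_iff_map_fun_eq_pi_map fun i => (hmeas _).aemeasurable] at h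
    simpa [hlaw] using h
  rw [indepFun_iff_map_prod_eq_prod_map_map (hmeas 0).aemeasurable hTm.aemeasurable, htuple,
    hlaw] at hpair
  have hS : MeasurableSet {p : EuclideanSpace ℝ (Fin d) × (T → EuclideanSpace ℝ (Fin d)) |
      p.1 ∈ A ∧ ∀ i, r < dist p.1 (p.2 i)} := by
    refine (measurable_fst hA).inter ?_
    have : {p : EuclideanSpace ℝ (Fin d) × (T → EuclideanSpace ℝ (Fin d)) |
        ∀ i, r < dist p.1 (p.2 i)} = ⋂ i, {p | r < dist p.1 (p.2 i)} := by
      ext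
      simp
    change MeasurableSet {p : EuclideanSpace ℝ (Fin d) × (T → EuclideanSpace ℝ (Fin d)) |
        ∀ i, r < dist p.1 (p.2 i)}
    rw [this]
    exact MeasurableSet.iInter fun i => measurableSet_lt measurable_const (by fun_prop)
  calc μ {ω | ξ 0 ω ∈ A ∧ r < nnRadius (fun i => ξ i ω) n 0}
      = μ.map (fun ω => (ξ 0 ω, fun i : T => ξ i ω))
          {p | p.1 ∈ A ∧ ∀ i, r < dist p.1 (p.2 i)} := by
        rw [Measure.map_apply ((hmeas 0).prodMk hTm) hS]
        congr 1
        ext ω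
        simp only [Set.mem_ofPred_eq, Set.mem_preimage, lt_nnRadius_iff hn, T, Subtype.forall,
          Finset.mem_erase, Finset.mem_range]
        exact and_congr_right fun _ => ⟨fun h j hj => h j hj.2 hj.1, fun h j h1 h2 => h j ⟨h2, h1⟩⟩
    _ = ∫⁻ x, Measure.pi (fun _ : T => P) (Prod.mk x ⁻¹' {p | p.1 ∈ A ∧
          ∀ i, r < dist p.1 (p.2 i)}) ∂P := by rw [hpair, Measure.prod_apply hS]
    _ = ∫⁻ x, A.indicator (fun x => P (Metric.closedBall x r)ᶜ ^ (n - 1)) x ∂P := by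
        refine lintegral_congr fun x => ?_
        by_cases hx : x ∈ A
        · have : Prod.mk x ⁻¹' {p : EuclideanSpace ℝ (Fin d) × (T → EuclideanSpace ℝ (Fin d)) |
              p.1 ∈ A ∧ ∀ i, r < dist p.1 (p.2 i)} =
              Set.univ.pi fun _ => (Metric.closedBall x r)ᶜ := by
            ext y
            simp [hx, dist_comm]
          rw [this, Measure.pi_pi, Set.indicator_of_mem hx]
          simp only [Finset.prod_const, Finset.card_univ, hTcard]
        · rw [Set.indicator_of_notMem hx]
          have : Prod.mk x ⁻¹' {p : EuclideanSpace ℝ (Fin d) × (T → EuclideanSpace ℝ (Fin d)) |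
              p.1 ∈ A ∧ ∀ i, r < dist p.1 (p.2 i)} = ∅ := by
            ext y
            simp [hx]
          rw [this, measure_empty]
    _ = _ := lintegral_indicator hA _

/-- The first observation and its nearest neighbour distance have the law of `(x, r)`, where `x` has
law `P` and `r` is the coupling radius at an independent exponential variable. -/
theorem map_nnRadius_eq (hP : ∀ (x : EuclideanSpace ℝ (Fin d)) r, P (Metric.sphere x r) = 0)
    (hmeas : ∀ i, Measurable (ξ i)) (hindep : iIndepFun ξ μ) (hlaw : ∀ i, μ.map (ξ i) = P)
    {n : ℕ} (hn : 2 ≤ n) :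
    μ.map (fun ω => (ξ 0 ω, nnRadius (fun i => ξ i ω) n 0)) =
      (P.prod (expMeasure 1)).map (fun p => (p.1, couplingRadius P n p)) := by
  have := isProbabilityMeasure_expMeasure one_pos
  have hm1 : Measurable fun ω => (ξ 0 ω, nnRadius (fun i => ξ i ω) n 0) :=
    (hmeas 0).prodMk (measurable_nnRadius hmeas n)
  have hc := measurable_couplingRadius hP hn
  have hm2 : Measurable fun p : EuclideanSpace ℝ (Fin d) × ℝ => (p.1, couplingRadius P n p) :=
    measurable_fst.prodMk hc
  have := Measure.isProbabilityMeasure_map (μ := μ) hm1.aemeasurable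
  have := Measure.isProbabilityMeasure_map (μ := P.prod (expMeasure 1)) hm2.aemeasurable
  refine Measure.ext_prod_iff.2 fun {A B} hA hB => ?_
  -- For fixed `A`, half-lines form a π-system generating the Borel sets, so equality of the tails
  -- suffices.
  have key : ∀ r : ℝ, μ.map (fun ω => (ξ 0 ω, nnRadius (fun i => ξ i ω) n 0)) (A ×ˢ Set.Ioi r) =
      (P.prod (expMeasure 1)).map (fun p => (p.1, couplingRadius P n p)) (A ×ˢ Set.Ioi r) := by
    intro r
    rw [Measure.map_apply hm1 (hA.prod measurableSet_Ioi),
      Measure.map_apply hm2 (hA.prod measurableSet_Ioi)]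
    refine (measure_lt_nnRadius hmeas hindep hlaw hn hA r).trans ?_
    rw [Measure.prod_apply (hm2 (hA.prod measurableSet_Ioi)), ← lintegral_indicator hA]
    refine lintegral_congr fun x => ?_
    by_cases hx : x ∈ A
    · rw [Set.indicator_of_mem hx, ← expMeasure_lt_couplingRadius hP hn]
      congr 1
      ext t
      simp [hx]
    · rw [Set.indicator_of_notMem hx]
      symm
      convert measure_empty (μ := expMeasure 1)
      ext t
      simp [hx]
  have hfst : ∀ Q : Measure (EuclideanSpace ℝ (Fin d) × ℝ), ∀ B, MeasurableSet B →
      ((Q.restrict (A ×ˢ Set.univ)).map Prod.snd) B = Q (A ×ˢ B) := by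
    intro Q B hB
    rw [Measure.map_apply measurable_snd hB, Measure.restrict_apply (measurable_snd hB)]
    congr 1
    ext p
    simp [and_comm]
  rw [← hfst _ B hB, ← hfst _ B hB]
  congr 1
  refine ext_of_generate_finite (Set.range Set.Ioi)
    (BorelSpace.measurable_eq.trans (borel_eq_generateFrom_Ioi ℝ)) isPiSystem_Ioi ?_ ?_
  · rintro _ ⟨r, rfl⟩
    rw [hfst _ _ measurableSet_Ioi, hfst _ _ measurableSet_Ioi, key]
  · rw [hfst _ _ MeasurableSet.univ, hfst _ _ MeasurableSet.univ,
      Measure.map_apply hm1 (hA.prod MeasurableSet.univ),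
      Measure.map_apply hm2 (hA.prod MeasurableSet.univ)]
    have h1 : (fun ω => (ξ 0 ω, nnRadius (fun i => ξ i ω) n 0)) ⁻¹' A ×ˢ Set.univ = ξ 0 ⁻¹' A := by
      ext
      simp
    have h2 : (fun p : EuclideanSpace ℝ (Fin d) × ℝ => (p.1, couplingRadius P n p)) ⁻¹'
        A ×ˢ Set.univ = A ×ˢ Set.univ := by
      ext
      simp
    rw [h1, h2, ← Measure.map_apply (hmeas 0) hA, hlaw, Measure.prod_prod]
    simp

end Law

end GMSP

namespace GMSP

/-! ### Averages over balls -/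

/-- The average over the ball with the coupling radius. -/
noncomputable def couplingAverage {E : Type*} [PseudoMetricSpace E] [MeasurableSpace E]
    (P : Measure E) (n : ℕ) (φ : E → ℝ≥0∞) (p : E × ℝ) : ℝ≥0∞ :=
  (P (Metric.closedBall p.1 (couplingRadius P n p)))⁻¹ *
    ∫⁻ y in Metric.closedBall p.1 (couplingRadius P n p), φ y ∂P

theorem measurable_setLIntegral_closedBall {E : Type*} [PseudoMetricSpace E]
    [SecondCountableTopology E] [MeasurableSpace E] [BorelSpace E] (Q : Measure E) [SFinite Q]
    {φ : E → ℝ≥0∞} (hφ : Measurable φ) :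
    Measurable fun p : E × ℝ => ∫⁻ y in Metric.closedBall p.1 p.2, φ y ∂Q := by
  have hs : MeasurableSet {p : (E × ℝ) × E | dist p.2 p.1.1 ≤ p.1.2} :=
    measurableSet_le (by fun_prop) (by fun_prop)
  have h := Measurable.lintegral_prod_right' (ν := Q)
    ((hφ.comp measurable_snd).indicator hs)
  convert h using 2 with p
  rw [← lintegral_indicator Metric.isClosed_closedBall.measurableSet]
  rfl

theorem tendsto_lintegral_tsub_natCast {E : Type*} [MeasurableSpace E]
    {P : Measure E} {φ : E → ℝ≥0∞} (hφ : Measurable φ) (hfin : ∫⁻ x, φ x ∂P < ∞) :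
    Tendsto (fun M : ℕ => ∫⁻ x, (φ x - M) ∂P) atTop (𝓝 0) := by
  have := tendsto_lintegral_of_dominated_convergence (μ := P) (F := fun (M : ℕ) x => φ x - M)
    (f := fun _ => 0) φ (fun M => hφ.sub_const _)
    (fun M => Eventually.of_forall fun x => tsub_le_self) hfin.ne (by
      filter_upwards [ae_lt_top hφ hfin.ne] with x hx
      obtain ⟨M, hM⟩ := ENNReal.exists_nat_gt hx.ne
      refine tendsto_const_nhds.congr' ?_
      filter_upwards [eventually_ge_atTop M] with k hk
      exact (tsub_eq_zero_of_le (hM.le.trans (by exact_mod_cast hk))).symm)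
  simpa using this

theorem ae_pos_snd {E : Type*} [MeasurableSpace E] {P : Measure E} [SFinite P] :
    ∀ᵐ p : E × ℝ ∂P.prod (expMeasure 1), 0 < p.2 := by
  have := isProbabilityMeasure_expMeasure one_pos
  exact Measure.quasiMeasurePreserving_snd.ae ae_pos_expMeasure

theorem couplingMass_pos {n : ℕ} (hn : 2 ≤ n) {t : ℝ} (ht : 0 < t) :
    0 < 1 - Real.exp (-(t / ((n : ℝ) - 1))) := by
  have hn' : (0 : ℝ) < n - 1 := by
    have : (2 : ℝ) ≤ n := by exact_mod_cast hn
    linarith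
  have : Real.exp (-(t / ((n : ℝ) - 1))) < 1 := Real.exp_lt_one_iff.2 (by
    have := div_pos ht hn'
    linarith)
  linarith

/-- The weight comes from `1 + n P(B) ≤ 1 + 2t`, which enters the domination squared. -/
theorem lintegral_sq_expMeasure_lt_top :
    ∫⁻ t, ENNReal.ofReal ((1 + 2 * t) ^ 2) ∂expMeasure 1 < ∞ := by
  have hden : expMeasure 1 = volume.withDensity (exponentialPDF 1) := rfl
  have hmeas : Measurable (exponentialPDF 1) :=
    (measurable_exponentialPDFReal 1).ennreal_ofReal
  rw [hden, lintegral_withDensity_eq_lintegral_mul _ hmeas (by fun_prop)]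
  have hint := integrableOn_exp_mul_Ioi (a := -(1 / 2 : ℝ)) (by norm_num) 0
  rw [← integrableOn_Ici_iff_integrableOn_Ioi] at hint
  have hle : ∀ t, (exponentialPDF 1 * fun t => ENNReal.ofReal ((1 + 2 * t) ^ 2)) t ≤
      (Set.Ici (0 : ℝ)).indicator
        (fun t => ENNReal.ofReal (64 * Real.exp (-(1 / 2 : ℝ) * t))) t := by
    intro t
    by_cases ht : 0 ≤ t
    · rw [Set.indicator_of_mem (Set.mem_Ici.2 ht), Pi.mul_apply, exponentialPDF_of_nonneg ht,
        ← ENNReal.ofReal_mul (by positivity)]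
      refine ENNReal.ofReal_le_ofReal ?_
      -- `1 + 2t ≤ 8 (1 + t/4) ≤ 8 exp(t/4)`; after squaring, half of the exponential decay is left.
      have h1 : t / 4 + 1 ≤ Real.exp (t / 4) := Real.add_one_le_exp _
      have h2 : (1 + 2 * t) ^ 2 ≤ 64 * Real.exp (t / 4) ^ 2 := by nlinarith
      have h3 : Real.exp (t / 4) ^ 2 = Real.exp (t / 2) := by
        rw [← Real.exp_nat_mul]
        congr 1
        push_cast
        ring
      have h4 : Real.exp (-(1 / 2 : ℝ) * t) = Real.exp (-t) * Real.exp (t / 2) := by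
        rw [← Real.exp_add]
        ring_nf
      rw [h4, one_mul, one_mul]
      rw [h3] at h2
      nlinarith [Real.exp_pos (-t)]
    · simp [ht, exponentialPDF_of_neg (not_le.1 ht)]
  refine (lintegral_mono hle).trans_lt ?_
  rw [lintegral_indicator measurableSet_Ici]
  exact (hint.const_mul 64).lintegral_lt_top

section Average

variable {E : Type*} [MetricSpace E] [SecondCountableTopology E] [MeasurableSpace E]
  [BorelSpace E] {P : Measure E} [IsProbabilityMeasure P]

theorem measurable_couplingAverage (hP : ∀ (x : E) r, P (Metric.sphere x r) = 0) {n : ℕ}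
    (hn : 2 ≤ n) {φ : E → ℝ≥0∞} (hφ : Measurable φ) : Measurable (couplingAverage P n φ) := by
  have h : Measurable fun p : E × ℝ => (p.1, couplingRadius P n p) :=
    measurable_fst.prodMk (measurable_couplingRadius hP hn)
  exact (((measurable_measure_closedBall P).comp h).inv).mul
    ((measurable_setLIntegral_closedBall P hφ).comp h)

theorem measure_closedBall_couplingRadius (hP : ∀ (x : E) r, P (Metric.sphere x r) = 0) {n : ℕ}
    (hn : 2 ≤ n) {x : E} {t : ℝ} (ht : 0 < t) :
    P (Metric.closedBall x (couplingRadius P n (x, t))) =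
      ENNReal.ofReal (1 - Real.exp (-(t / ((n : ℝ) - 1)))) := by
  rw [← real_closedBall_couplingRadius hP hn ht (x := x), ofReal_measureReal]

/-- A ball of radius `0` is a sphere of radius `0`, hence null, while the prescribed mass is
positive. -/
theorem couplingRadius_pos (hP : ∀ (x : E) r, P (Metric.sphere x r) = 0) {n : ℕ}
    (hn : 2 ≤ n) {x : E} {t : ℝ} (ht : 0 < t) : 0 < couplingRadius P n (x, t) := by
  by_contra! h
  rw [couplingRadius_le_iff hP hn ht, Metric.closedBall_zero, ← Metric.sphere_zero,
    Measure.real, hP] at h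
  exact absurd h (not_le.2 (by simpa using couplingMass_pos hn ht))

/-- Averaging over the coupling balls is bounded in mean. -/
theorem exists_lintegral_couplingAverage_le (E : Type*) [MetricSpace E]
    [SecondCountableTopology E] [HasBesicovitchCovering E] [MeasurableSpace E] [BorelSpace E] :
    ∃ N : ℕ, ∀ (P : Measure E) [IsProbabilityMeasure P],
      (∀ (x : E) r, P (Metric.sphere x r) = 0) → ∀ (n : ℕ), 2 ≤ n → ∀ (t : ℝ), 0 < t →
      ∀ φ : E → ℝ≥0∞, Measurable φ →
      ∫⁻ x, couplingAverage P n φ (x, t) ∂P ≤ N * ∫⁻ x, φ x ∂P := by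
  obtain ⟨N, hN⟩ := exists_measure_mem_closedBall_le E
  refine ⟨N, fun P _ hP n hn t ht φ hφ => ?_⟩
  set u := ENNReal.ofReal (1 - Real.exp (-(t / ((n : ℝ) - 1)))) with hu
  have hu0 : u ≠ 0 := by simpa [hu] using couplingMass_pos hn ht
  have hut : u ≠ ∞ := ENNReal.ofReal_ne_top
  have hρ : Measurable fun x => couplingRadius P n (x, t) :=
    (measurable_couplingRadius hP hn).comp (measurable_id.prodMk measurable_const)
  have hs : MeasurableSet {p : E × E | dist p.2 p.1 ≤ couplingRadius P n (p.1, t)} :=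
    measurableSet_le (by fun_prop) (hρ.comp measurable_fst)
  calc ∫⁻ x, couplingAverage P n φ (x, t) ∂P
      = ∫⁻ x, u⁻¹ * ∫⁻ y, {p : E × E | dist p.2 p.1 ≤ couplingRadius P n (p.1, t)}.indicator
          (fun p => φ p.2) (x, y) ∂P ∂P := by
        refine lintegral_congr fun x => ?_
        rw [couplingAverage, measure_closedBall_couplingRadius hP hn ht,
          ← lintegral_indicator Metric.isClosed_closedBall.measurableSet]
        rfl
    _ = u⁻¹ * ∫⁻ y, ∫⁻ x, {p : E × E | dist p.2 p.1 ≤ couplingRadius P n (p.1, t)}.indicator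
          (fun p => φ p.2) (x, y) ∂P ∂P := by
        have hm : Measurable ({p : E × E | dist p.2 p.1 ≤ couplingRadius P n (p.1, t)}.indicator
            fun p => φ p.2) := (hφ.comp measurable_snd).indicator hs
        rw [lintegral_const_mul _ hm.lintegral_prod_right', lintegral_lintegral_swap]
        exact hm.aemeasurable
    _ = u⁻¹ * ∫⁻ y, φ y * P {x | y ∈ Metric.closedBall x (couplingRadius P n (x, t))} ∂P := by
        congr 1
        refine lintegral_congr fun y => ?_
        have hsy : MeasurableSet {x | y ∈ Metric.closedBall x (couplingRadius P n (x, t))} :=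
          measurableSet_le (by fun_prop) hρ
        rw [← lintegral_indicator_const hsy]
        rfl
    -- After Fubini, Besicovitch bounds the mass of the centres whose ball contains `y`; the
    -- normalising `u⁻¹` cancels, so the bound depends neither on `n` nor on `t`.
    _ ≤ u⁻¹ * ∫⁻ y, φ y * (N * u) ∂P := by
        gcongr with y
        exact hN P _ u y (fun x => couplingRadius_pos hP hn ht)
          fun x => (measure_closedBall_couplingRadius hP hn ht).le
    _ = N * ∫⁻ x, φ x ∂P := by
        rw [lintegral_mul_const _ hφ]
        calc _ = (u⁻¹ * u) * (N * ∫⁻ x, φ x ∂P) := by ring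
          _ = _ := by rw [ENNReal.inv_mul_cancel hu0 hut, one_mul]

/-- The averages of an integrable function over the coupling balls are uniformly integrable. -/
theorem exists_couplingAverage_dominated [HasBesicovitchCovering E]
    (hP : ∀ (x : E) r, P (Metric.sphere x r) = 0) {φ : E → ℝ≥0∞} (hφ : Measurable φ)
    (hfin : ∫⁻ x, φ x ∂P < ∞) {ε : ℝ≥0∞} (hε : 0 < ε) :
    ∃ (M : ℕ) (b : ℕ → E × ℝ → ℝ≥0∞), ∀ n, 2 ≤ n →
      ∫⁻ p, ENNReal.ofReal ((1 + 2 * p.2) ^ 2) * b n p ∂P.prod (expMeasure 1) ≤ ε ∧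
      ∀ p : E × ℝ, 0 < p.2 → couplingAverage P n φ p ≤ M + b n p := by
  have := isProbabilityMeasure_expMeasure one_pos
  obtain ⟨N, hN⟩ := exists_lintegral_couplingAverage_le E
  set c := ∫⁻ t, ENNReal.ofReal ((1 + 2 * t) ^ 2) ∂expMeasure 1 with hc
  have hcfin : c ≠ ∞ := lintegral_sq_expMeasure_lt_top.ne
  have hlim : Tendsto (fun M : ℕ => c * (N * ∫⁻ x, (φ x - M) ∂P)) atTop (𝓝 0) := by
    have := ENNReal.Tendsto.const_mul (a := c) (ENNReal.Tendsto.const_mul (a := (N : ℝ≥0∞))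
      (tendsto_lintegral_tsub_natCast hφ hfin) (Or.inr (by simp))) (Or.inr hcfin)
    simpa using this
  obtain ⟨M, hM⟩ := (ENNReal.tendsto_nhds_zero.1 hlim ε hε).exists
  -- Truncation: `φ ≤ M + (φ - M)`, and the averages of the excess inherit its small mean.
  refine ⟨M, fun n => couplingAverage P n fun x => φ x - M, fun n hn => ⟨?_, ?_⟩⟩
  · refine le_trans ?_ hM
    have hmφ : Measurable fun x => φ x - (M : ℝ≥0∞) := hφ.sub_const _
    have hma := measurable_couplingAverage hP hn hmφ
    have hw : Measurable fun p : E × ℝ => ENNReal.ofReal ((1 + 2 * p.2) ^ 2) := by fun_prop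
    refine (lintegral_prod_symm' _ (hw.mul hma)).trans_le ?_
    simp only [Pi.mul_apply]
    calc _ = ∫⁻ t, ENNReal.ofReal ((1 + 2 * t) ^ 2) *
          ∫⁻ x, couplingAverage P n (fun x => φ x - M) (x, t) ∂P ∂expMeasure 1 := by
          refine lintegral_congr fun t => ?_
          rw [lintegral_const_mul]
          exact hma.comp (measurable_id.prodMk measurable_const)
      _ ≤ ∫⁻ t, ENNReal.ofReal ((1 + 2 * t) ^ 2) * (N * ∫⁻ x, (φ x - M) ∂P) ∂expMeasure 1 := by
          refine lintegral_mono_ae ?_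
          filter_upwards [ae_pos_expMeasure] with t ht
          gcongr
          exact hN P hP n hn t ht _ hmφ
      _ = _ := by rw [lintegral_mul_const _ (by fun_prop)]
  · rintro ⟨x, t⟩ ht
    have hm0 : P (Metric.closedBall x (couplingRadius P n (x, t))) ≠ 0 := by
      rw [measure_closedBall_couplingRadius hP hn ht]
      simpa using couplingMass_pos hn ht
    set B := Metric.closedBall x (couplingRadius P n (x, t)) with hB
    calc couplingAverage P n φ (x, t) ≤ (P B)⁻¹ * ∫⁻ y in B, (M + (φ y - M)) ∂P := by
          rw [couplingAverage]
          gcongr with y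
          exact le_add_tsub
      _ = (P B)⁻¹ * (M * P B) + (P B)⁻¹ * ∫⁻ y in B, (φ y - M) ∂P := by
          rw [lintegral_add_left measurable_const, setLIntegral_const, mul_add]
      _ = M + (P B)⁻¹ * ∫⁻ y in B, (φ y - M) ∂P := by
          rw [mul_left_comm, ENNReal.inv_mul_cancel hm0 (measure_ne_top _ _), mul_one]
      _ = _ := rfl

end Average

end GMSP

namespace GMSP

/-! ### Continuous families of functions on balls -/

/-- Used to turn suprema over `Θ₀` into countable ones, which are measurable. -/
theorem exists_countable_subset_closure {T : Type*} [PseudoMetricSpace T]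
    [SecondCountableTopology T] (K : Set T) : ∃ D ⊆ K, D.Countable ∧ K ⊆ closure D :=
  (TopologicalSpace.IsSeparable.of_separableSpace K).exists_countable_dense_subset

theorem forall_le_const_mul_of_subset_closure {T : Type*} [TopologicalSpace T] {K D : Set T}
    (hDK : D ⊆ K) (hKD : K ⊆ closure D) {a b : T → ℝ≥0∞} (ha : ContinuousOn a K)
    (hb : ContinuousOn b K) {S : ℝ≥0∞} (hS : S ≠ ∞) (h : ∀ θ ∈ D, a θ ≤ S * b θ) :
    ∀ θ ∈ K, a θ ≤ S * b θ := fun θ hθ =>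
  ContinuousWithinAt.closure_le (hKD hθ) ((ha θ hθ).mono hDK)
    (ENNReal.Tendsto.const_mul ((hb θ hθ).mono hDK) (Or.inr hS)) h

/-- The quotient need not be continuous where `b` vanishes, but for finite `S` the condition `a ≤ S
* b` is closed and passes from `D` to its closure. -/
theorem biSup_div_eq_of_subset_closure {T : Type*} [TopologicalSpace T] {K D : Set T}
    (hDK : D ⊆ K) (hKD : K ⊆ closure D) {a b : T → ℝ≥0∞} (ha : ContinuousOn a K)
    (hb : ContinuousOn b K) (hbt : ∀ θ ∈ K, b θ ≠ ∞) :
    ⨆ θ ∈ K, a θ / b θ = ⨆ θ ∈ D, a θ / b θ := by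
  refine le_antisymm (iSup₂_le fun θ hθ => ?_) (biSup_mono fun θ hθ => hDK hθ)
  by_cases hS : ⨆ θ ∈ D, a θ / b θ = ∞
  · rw [hS]
    exact le_top
  · refine ENNReal.div_le_of_le_mul ?_
    refine forall_le_const_mul_of_subset_closure hDK hKD ha hb hS (fun t ht => ?_) θ hθ
    rw [← ENNReal.div_le_iff_le_mul]
    · exact le_biSup (fun θ => a θ / b θ) ht
    · by_cases h0 : b t = 0
      · exact Or.inr hS
      · exact Or.inl h0
    · exact Or.inl (hbt t (hDK ht))

theorem exists_norm_le_of_continuousOn {T E F : Type*} [TopologicalSpace T]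
    [PseudoMetricSpace E] [ProperSpace E] [NormedAddCommGroup F] {K : Set T} {φ : T → E → F}
    (hK : IsCompact K)
    (hφ : ContinuousOn (fun p : T × E => φ p.1 p.2) (K ×ˢ Set.univ)) (x : E) (r : ℝ) :
    ∃ C : ℝ, 0 ≤ C ∧ ∀ θ ∈ K, ∀ y ∈ Metric.closedBall x r, ‖φ θ y‖ ≤ C := by
  have hc : IsCompact (K ×ˢ Metric.closedBall x r) := hK.prod (isCompact_closedBall x r)
  obtain ⟨C, hC⟩ := hc.exists_bound_of_continuousOn
    (hφ.mono (Set.prod_mono_right (Set.subset_univ _)))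
  exact ⟨max C 0, le_max_right _ _, fun θ hθ y hy => (hC (θ, y) ⟨hθ, hy⟩).trans (le_max_left _ _)⟩

theorem continuous_of_continuousOn_prod {T E F : Type*} [TopologicalSpace T] [TopologicalSpace E]
    [TopologicalSpace F] {K : Set T} {φ : T → E → F}
    (hφ : ContinuousOn (fun p : T × E => φ p.1 p.2) (K ×ˢ Set.univ)) {θ : T} (hθ : θ ∈ K) :
    Continuous (φ θ) := by
  have : ContinuousOn ((fun p : T × E => φ p.1 p.2) ∘ fun y => (θ, y)) Set.univ :=
    hφ.comp (by fun_prop) fun y _ => ⟨hθ, trivial⟩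
  exact continuousOn_univ.1 this

theorem continuousOn_param {T E F : Type*} [TopologicalSpace T] [TopologicalSpace E]
    [TopologicalSpace F] {K : Set T} {φ : T → E → F}
    (hφ : ContinuousOn (fun p : T × E => φ p.1 p.2) (K ×ˢ Set.univ)) (y : E) :
    ContinuousOn (fun θ => φ θ y) K := by
  have : ContinuousOn ((fun p : T × E => φ p.1 p.2) ∘ fun θ => (θ, y)) K :=
    hφ.comp (by fun_prop) fun θ hθ => ⟨hθ, trivial⟩
  exact this

section Family

variable {T E F : Type*} [PseudoMetricSpace T] [NormedAddCommGroup E] [NormedSpace ℝ E]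
  [FiniteDimensional ℝ E] [MeasureSpace E] [BorelSpace E]
  [(volume : Measure E).IsAddHaarMeasure] [NormedAddCommGroup F] {K : Set T} {φ : T → E → F}

theorem continuousOn_setLIntegral_enorm (hK : IsCompact K)
    (hφ : ContinuousOn (fun p : T × E => φ p.1 p.2) (K ×ˢ Set.univ)) (x : E) (r : ℝ) :
    ContinuousOn (fun θ => ∫⁻ y in Metric.closedBall x r, ‖φ θ y‖ₑ) K := by
  obtain ⟨C, hC0, hC⟩ := exists_norm_le_of_continuousOn hK hφ x r
  intro θ hθ
  refine tendsto_lintegral_filter_of_dominated_convergence (fun _ => ENNReal.ofReal C) ?_ ?_ ?_ ?_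
  · filter_upwards [self_mem_nhdsWithin] with s hs
    exact (continuous_of_continuousOn_prod hφ hs).enorm.measurable
  · filter_upwards [self_mem_nhdsWithin] with s hs
    filter_upwards [ae_restrict_mem Metric.isClosed_closedBall.measurableSet] with y hy
    rw [← ofReal_norm]
    exact ENNReal.ofReal_le_ofReal (hC s hs y hy)
  · rw [setLIntegral_const]
    exact ENNReal.mul_ne_top ENNReal.ofReal_ne_top (measure_closedBall_lt_top).ne
  · exact Eventually.of_forall fun y => (continuousOn_param hφ y θ hθ).enorm

/-- Averages over shrinking balls of a continuous family converge, along convergent parameters. -/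
theorem tendsto_average_closedBall [NormedSpace ℝ F] [CompleteSpace F]
    (hφ : ContinuousOn (fun p : T × E => φ p.1 p.2) (K ×ˢ Set.univ)) {s : ℕ → T} {θ : T}
    (hs : ∀ k, s k ∈ K) (hθ : θ ∈ K) (hlim : Tendsto s atTop (𝓝 θ)) (x : E) {r : ℕ → ℝ}
    (hr : ∀ k, 0 < r k) (hr0 : Tendsto r atTop (𝓝 0)) :
    Tendsto (fun k => (volume.real (Metric.closedBall x (r k)))⁻¹ •
      ∫ y in Metric.closedBall x (r k), φ (s k) y) atTop (𝓝 (φ θ x)) := by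
  rw [Metric.tendsto_atTop']
  intro ε hε
  have h1 := hφ (θ, x) ⟨hθ, trivial⟩
  rw [Metric.continuousWithinAt_iff] at h1
  obtain ⟨δ, hδ, h⟩ := h1 (ε / 2) (by positivity)
  have h2 : ∀ᶠ k in atTop, dist (s k) θ < δ := (Metric.tendsto_nhds.1 hlim) δ hδ
  have h3 : ∀ᶠ k in atTop, r k < δ := hr0.eventually (gt_mem_nhds hδ)
  obtain ⟨N, hN⟩ := eventually_atTop.1 (h2.and h3)
  refine ⟨N, fun k hk => ?_⟩
  obtain ⟨hk1, hk2⟩ := hN k hk.le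
  set B := Metric.closedBall x (r k) with hB
  have hBpos : 0 < volume.real B :=
    ENNReal.toReal_pos (Metric.measure_closedBall_pos _ _ (hr k)).ne'
      measure_closedBall_lt_top.ne
  have hint : IntegrableOn (φ (s k)) B :=
    (continuous_of_continuousOn_prod hφ (hs k)).continuousOn.integrableOn_compact
      (isCompact_closedBall _ _)
  have hle : ‖∫ y in B, (φ (s k) y - φ θ x)‖ ≤ ε / 2 * volume.real B := by
    refine norm_setIntegral_le_of_norm_le_const measure_closedBall_lt_top fun y hy => ?_
    rw [← dist_eq_norm]
    refine (h (x := (s k, y)) ⟨hs k, trivial⟩ ?_).le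
    rw [Prod.dist_eq]
    exact max_lt hk1 ((Metric.mem_closedBall.1 hy).trans_lt hk2)
  have hsub : (volume.real B)⁻¹ • ∫ y in B, (φ (s k) y - φ θ x) =
      (volume.real B)⁻¹ • (∫ y in B, φ (s k) y) - φ θ x := by
    rw [integral_sub hint (integrableOn_const measure_closedBall_lt_top.ne), setIntegral_const,
      smul_sub, inv_smul_smul₀ hBpos.ne']
  rw [dist_eq_norm, ← hsub, norm_smul, norm_inv, Real.norm_of_nonneg hBpos.le,
    inv_mul_lt_iff₀ hBpos]
  nlinarith

end Family

theorem abs_apply_le_norm_mul_sum {q : ℕ} (L : EuclideanSpace ℝ (Fin q) →L[ℝ] ℝ)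
    (w : EuclideanSpace ℝ (Fin q)) :
    |L w| ≤ ‖w‖ * ∑ j, |L (EuclideanSpace.single j 1)| := by
  have hw : w = ∑ j, w j • EuclideanSpace.single j (1 : ℝ) := by
    simpa using ((EuclideanSpace.basisFun (Fin q) ℝ).sum_repr w).symm
  conv_lhs => rw [hw, map_sum]
  rw [Finset.mul_sum]
  refine (Finset.abs_sum_le_sum_abs _ _).trans (Finset.sum_le_sum fun j _ => ?_)
  rw [map_smul, smul_eq_mul, abs_mul]
  gcongr
  exact PiLp.norm_apply_le w j

end GMSP

namespace GMSP

/-! ### The regular model -/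

variable {d q : ℕ}

/-- The assumptions on the densities that do not involve the sample. That the derivatives vanish
where the density does is a consequence of non-negativity near the points of `Θ₀`. -/
structure RegularModel (f : EuclideanSpace ℝ (Fin q) → EuclideanSpace ℝ (Fin d) → ℝ)
    (θ₀ : EuclideanSpace ℝ (Fin q)) (Θ₀ : Set (EuclideanSpace ℝ (Fin q))) : Prop where
  density : ∀ θ ∈ Θ₀, IsDensity (f θ)
  mem : θ₀ ∈ Θ₀
  compact : IsCompact Θ₀
  convex : Convex ℝ Θ₀
  ac : ∀ θ ∈ Θ₀, law (f θ) ≪ law (f θ₀)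
  smooth : SmoothFamily f Θ₀
  sq : SquareIntegrableSup f θ₀ Θ₀
  pd_eq_zero : ∀ θ ∈ Θ₀, ∀ x j, f θ x = 0 → pd f j θ x = 0

/-- A zero of a non-negative function is a minimum, and it is a local one because `θ` is interior to
`Θ`. -/
theorem pd_eq_zero_of_eq_zero {f : EuclideanSpace ℝ (Fin q) → EuclideanSpace ℝ (Fin d) → ℝ}
    {Θ : Set (EuclideanSpace ℝ (Fin q))} (hf : ∀ θ ∈ Θ, IsDensity (f θ))
    {θ : EuclideanSpace ℝ (Fin q)} (hθ : θ ∈ interior Θ) {x : EuclideanSpace ℝ (Fin d)} (j : Fin q)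
    (h : f θ x = 0) : pd f j θ x = 0 := by
  have hmin : IsLocalMin (fun t => f t x) θ := by
    filter_upwards [mem_interior_iff_mem_nhds.1 hθ] with t ht
    rw [h]
    exact (hf t ht).nonneg x
  rw [pd, hmin.fderiv_eq_zero]
  rfl

variable {f : EuclideanSpace ℝ (Fin q) → EuclideanSpace ℝ (Fin d) → ℝ}
  {θ₀ θ : EuclideanSpace ℝ (Fin q)} {Θ₀ : Set (EuclideanSpace ℝ (Fin q))}

theorem IsDensity.isProbabilityMeasure_law {p : EuclideanSpace ℝ (Fin d) → ℝ} (hp : IsDensity p) :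
    IsProbabilityMeasure (law p) :=
  ⟨by rw [law, withDensity_apply _ MeasurableSet.univ, Measure.restrict_univ, hp.lintegral_eq_one]⟩

theorem law_sphere (hd : 0 < d) (p : EuclideanSpace ℝ (Fin d) → ℝ) (x : EuclideanSpace ℝ (Fin d))
    (r : ℝ) : law p (Metric.sphere x r) = 0 := by
  have : Nonempty (Fin d) := ⟨⟨0, hd⟩⟩
  exact withDensity_absolutelyContinuous _ _ (Measure.addHaar_sphere _ _ _)

/-- `∫_B |∇ f_θ|`, with the sum of the absolute values of the components as norm. -/
noncomputable def gradMass (f : EuclideanSpace ℝ (Fin q) → EuclideanSpace ℝ (Fin d) → ℝ)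
    (θ : EuclideanSpace ℝ (Fin q)) (B : Set (EuclideanSpace ℝ (Fin d))) : ℝ≥0∞ :=
  ∑ j, ∫⁻ y in B, ‖pd f j θ y‖ₑ

/-- The supremum over `Θ₀` of the components of `∇ f_θ(y) / g(y)`, summed. -/
noncomputable def gradSup (f : EuclideanSpace ℝ (Fin q) → EuclideanSpace ℝ (Fin d) → ℝ)
    (θ₀ : EuclideanSpace ℝ (Fin q)) (Θ₀ : Set (EuclideanSpace ℝ (Fin q)))
    (y : EuclideanSpace ℝ (Fin d)) : ℝ≥0∞ :=
  ∑ j, ⨆ θ ∈ Θ₀, ‖pd f j θ y / f θ₀ y‖ₑ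

namespace RegularModel

theorem continuous_density (M : RegularModel f θ₀ Θ₀) (hθ : θ ∈ Θ₀) : Continuous (f θ) :=
  continuous_of_continuousOn_prod M.smooth.continuousOn hθ

theorem continuous_pd (M : RegularModel f θ₀ Θ₀) (hθ : θ ∈ Θ₀) (j : Fin q) :
    Continuous (pd f j θ) :=
  continuous_of_continuousOn_prod (M.smooth.continuousOn_pd j) hθ

theorem continuousOn_grad (M : RegularModel f θ₀ Θ₀) :
    ContinuousOn (fun p : EuclideanSpace ℝ (Fin q) × EuclideanSpace ℝ (Fin d) => grad f p.1 p.2)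
      (Θ₀ ×ˢ Set.univ) :=
  (PiLp.continuous_toLp 2 _).comp_continuousOn
    (continuousOn_pi.2 fun j => M.smooth.continuousOn_pd j)

theorem continuous_grad (M : RegularModel f θ₀ Θ₀) (hθ : θ ∈ Θ₀) : Continuous (grad f θ) :=
  continuous_of_continuousOn_prod M.continuousOn_grad hθ

theorem law_apply {p : EuclideanSpace ℝ (Fin d) → ℝ} {B : Set (EuclideanSpace ℝ (Fin d))}
    (hB : MeasurableSet B) : law p B = ∫⁻ y in B, ENNReal.ofReal (p y) :=
  withDensity_apply _ hB

theorem law_apply_enorm (M : RegularModel f θ₀ Θ₀) (hθ : θ ∈ Θ₀)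
    {B : Set (EuclideanSpace ℝ (Fin d))} (hB : MeasurableSet B) :
    law (f θ) B = ∫⁻ y in B, ‖f θ y‖ₑ := by
  rw [law_apply hB]
  exact lintegral_congr fun y => (Real.enorm_of_nonneg ((M.density θ hθ).nonneg y)).symm

theorem integrableOn_density (M : RegularModel f θ₀ Θ₀) (hθ : θ ∈ Θ₀)
    (x : EuclideanSpace ℝ (Fin d)) (r : ℝ) : IntegrableOn (f θ) (Metric.closedBall x r) :=
  (M.continuous_density hθ).continuousOn.integrableOn_compact (isCompact_closedBall _ _)

theorem law_real_closedBall (M : RegularModel f θ₀ Θ₀) (hθ : θ ∈ Θ₀)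
    (x : EuclideanSpace ℝ (Fin d)) (r : ℝ) :
    (law (f θ)).real (Metric.closedBall x r) = ∫ y in Metric.closedBall x r, f θ y := by
  rw [Measure.real, law_apply Metric.isClosed_closedBall.measurableSet,
    integral_eq_lintegral_of_nonneg_ae (Eventually.of_forall (M.density θ hθ).nonneg)
      (M.continuous_density hθ).aestronglyMeasurable.restrict]

theorem ae_eq_zero (M : RegularModel f θ₀ Θ₀) (hθ : θ ∈ Θ₀) : ∀ᵐ y, f θ₀ y = 0 → f θ y = 0 := by
  have hm : MeasurableSet {y | f θ₀ y = 0} :=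
    (M.density θ₀ M.mem).measurable (measurableSet_singleton 0)
  have h0 : law (f θ₀) {y | f θ₀ y = 0} = 0 := by
    rw [law_apply hm]
    refine (setLIntegral_congr_fun hm fun y hy => ?_).trans lintegral_zero
    simp only [Set.mem_ofPred_eq] at hy
    simp [hy]
  have h1 := M.ac θ hθ h0
  rw [law_apply hm, setLIntegral_eq_zero_iff hm (M.density θ hθ).measurable.ennreal_ofReal] at h1
  filter_upwards [h1] with y hy h
  exact le_antisymm (ENNReal.ofReal_eq_zero.1 (hy h)) ((M.density θ hθ).nonneg y)

theorem ae_pos (M : RegularModel f θ₀ Θ₀) : ∀ᵐ y ∂law (f θ₀), 0 < f θ₀ y := by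
  rw [law, ae_withDensity_iff (M.density θ₀ M.mem).measurable.ennreal_ofReal]
  refine Eventually.of_forall fun y hy => ?_
  simpa using hy

theorem setLIntegral_law (M : RegularModel f θ₀ Θ₀) {φ : EuclideanSpace ℝ (Fin d) → ℝ≥0∞}
    (hφ : Measurable φ) {B : Set (EuclideanSpace ℝ (Fin d))} (hB : MeasurableSet B) :
    ∫⁻ y in B, φ y ∂law (f θ₀) = ∫⁻ y in B, ENNReal.ofReal (f θ₀ y) * φ y := by
  rw [law, restrict_withDensity hB, lintegral_withDensity_eq_lintegral_mul _
    (M.density θ₀ M.mem).measurable.ennreal_ofReal hφ]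
  rfl

theorem biSup_pd_eq (M : RegularModel f θ₀ Θ₀) {D : Set (EuclideanSpace ℝ (Fin q))} (hD : D ⊆ Θ₀)
    (hcl : Θ₀ ⊆ closure D) (j : Fin q) (y : EuclideanSpace ℝ (Fin d)) :
    ⨆ θ ∈ Θ₀, ‖pd f j θ y / f θ₀ y‖ₑ = ⨆ θ ∈ D, ‖pd f j θ y / f θ₀ y‖ₑ := by
  have := biSup_div_eq_of_subset_closure hD hcl (a := fun θ => ‖pd f j θ y / f θ₀ y‖ₑ)
    (b := fun _ => 1) ((continuousOn_param (M.smooth.continuousOn_pd j) y).div_const _).enorm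
    continuousOn_const (by simp)
  simpa using this

theorem measurable_biSup_pd (M : RegularModel f θ₀ Θ₀) (j : Fin q) :
    Measurable fun y => ⨆ θ ∈ Θ₀, ‖pd f j θ y / f θ₀ y‖ₑ := by
  obtain ⟨D, hD, hDc, hcl⟩ := exists_countable_subset_closure Θ₀
  simp_rw [M.biSup_pd_eq hD hcl]
  exact Measurable.biSup D hDc fun θ hθ =>
    ((M.continuous_pd (hD hθ) j).measurable.div (M.density θ₀ M.mem).measurable).enorm

theorem measurable_gradSup (M : RegularModel f θ₀ Θ₀) : Measurable (gradSup f θ₀ Θ₀) :=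
  Finset.measurable_sum _ fun j _ => M.measurable_biSup_pd j

theorem lintegral_gradSup_sq_lt_top (M : RegularModel f θ₀ Θ₀) :
    ∫⁻ y, (1 + gradSup f θ₀ Θ₀ y) ^ 2 ∂law (f θ₀) < ∞ := by
  have := (M.density θ₀ M.mem).isProbabilityMeasure_law
  -- The hypothesis has the square inside the supremum, `gradSup` outside.
  have hsup : ∀ j y, (⨆ θ ∈ Θ₀, ‖pd f j θ y / f θ₀ y‖ₑ) ^ (2 : ℝ) ≤
      ⨆ θ ∈ Θ₀, ‖pd f j θ y / f θ₀ y‖ₑ ^ 2 := by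
    intro j y
    rw [← ENNReal.le_rpow_inv_iff two_pos]
    refine iSup₂_le fun θ hθ => ?_
    rw [ENNReal.le_rpow_inv_iff two_pos, ENNReal.rpow_two]
    exact le_biSup (fun θ => ‖pd f j θ y / f θ₀ y‖ₑ ^ 2) hθ
  have hle : ∀ y, (1 + gradSup f θ₀ Θ₀ y) ^ 2 ≤
      2 * (1 + q * ∑ j, (⨆ θ ∈ Θ₀, ‖pd f j θ y / f θ₀ y‖ₑ) ^ (2 : ℝ)) := by
    intro y
    have h1 := ENNReal.rpow_add_le_mul_rpow_add_rpow 1 (gradSup f θ₀ Θ₀ y) (p := 2) (by norm_num)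
    have h2 := ENNReal.rpow_sum_le_const_mul_sum_rpow (Finset.univ : Finset (Fin q))
      (fun j => ⨆ θ ∈ Θ₀, ‖pd f j θ y / f θ₀ y‖ₑ) (p := 2) (by norm_num)
    norm_num at h1 h2
    calc _ ≤ _ := h1
      _ ≤ _ := by
        gcongr
        simpa [gradSup] using h2
  refine (lintegral_mono hle).trans_lt ?_
  have hm : ∀ j, Measurable fun y => (⨆ θ ∈ Θ₀, ‖pd f j θ y / f θ₀ y‖ₑ) ^ (2 : ℝ) :=
    fun j => (M.measurable_biSup_pd j).pow_const _
  have hms := Finset.measurable_fun_sum Finset.univ fun j _ => hm j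
  rw [lintegral_const_mul _ (by fun_prop), lintegral_add_left measurable_const, lintegral_const_mul _ hms,
    lintegral_finsetSum _ fun j _ => hm j]
  have hfin : ∑ j, ∫⁻ y, (⨆ θ ∈ Θ₀, ‖pd f j θ y / f θ₀ y‖ₑ) ^ (2 : ℝ) ∂law (f θ₀) < ∞ :=
    ENNReal.sum_lt_top.2 fun j _ => (lintegral_mono (hsup j)).trans_lt (M.sq j)
  simp only [lintegral_const, measure_univ]
  finiteness

/-- Where `g = 0`, absolute continuity gives `f_θ = 0` almost everywhere, and then the gradient
vanishes too. Elsewhere write `∇f_θ = g (∇f_θ / g)`. -/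
theorem gradMass_le (M : RegularModel f θ₀ Θ₀) (hθ : θ ∈ Θ₀) {B : Set (EuclideanSpace ℝ (Fin d))}
    (hB : MeasurableSet B) : gradMass f θ B ≤ ∫⁻ y in B, gradSup f θ₀ Θ₀ y ∂law (f θ₀) := by
  rw [M.setLIntegral_law M.measurable_gradSup hB, gradMass,
    ← lintegral_finsetSum _ fun j _ => (M.continuous_pd hθ j).enorm.measurable]
  refine lintegral_mono_ae (ae_restrict_of_ae ?_)
  filter_upwards [M.ae_eq_zero hθ] with y hy
  rw [gradSup, Finset.mul_sum]
  refine Finset.sum_le_sum fun j _ => ?_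
  by_cases h0 : f θ₀ y = 0
  · simp [M.pd_eq_zero θ hθ y j (hy h0)]
  · have hpos : 0 ≤ f θ₀ y := (M.density θ₀ M.mem).nonneg y
    calc ‖pd f j θ y‖ₑ = ‖f θ₀ y * (pd f j θ y / f θ₀ y)‖ₑ := by rw [mul_div_cancel₀ _ h0]
      _ = ENNReal.ofReal (f θ₀ y) * ‖pd f j θ y / f θ₀ y‖ₑ := by
        rw [enorm_mul, Real.enorm_of_nonneg hpos]
      _ ≤ _ := by
        gcongr
        exact le_biSup (fun θ => ‖pd f j θ y / f θ₀ y‖ₑ) hθ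

theorem hasFDerivAt (M : RegularModel f θ₀ Θ₀) (hθ : θ ∈ Θ₀) (y : EuclideanSpace ℝ (Fin d)) :
    HasFDerivAt (fun t => f t y) (fderiv ℝ (fun t => f t y) θ) θ :=
  ((M.smooth.contDiffAt y θ hθ).differentiableAt (by norm_num)).hasFDerivAt

/-- Mean value inequality in `θ` on the convex set `Θ₀`: the derivative is bounded there by `g`
times `gradSup`. -/
theorem density_le (M : RegularModel f θ₀ Θ₀) {C : ℝ≥0} (hC : ∀ θ ∈ Θ₀, ‖θ - θ₀‖ ≤ C)
    (hθ : θ ∈ Θ₀) : ∀ᵐ y, ENNReal.ofReal (f θ y) ≤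
      ENNReal.ofReal (f θ₀ y) * (1 + C * gradSup f θ₀ Θ₀ y) := by
  filter_upwards [M.ae_eq_zero hθ] with y hy
  by_cases h0 : f θ₀ y = 0
  · simp [hy h0]
  have hpos : 0 < f θ₀ y := lt_of_le_of_ne ((M.density θ₀ M.mem).nonneg y) (Ne.symm h0)
  rcases eq_or_ne (gradSup f θ₀ Θ₀ y) ∞ with hG | hG
  -- If `gradSup` is infinite the right side is `∞`, unless `C = 0`, which forces `θ = θ₀`.
  · rcases eq_or_ne C 0 with hC0 | hC0
    · have : θ = θ₀ := by
        have := hC θ hθ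
        rw [hC0, NNReal.coe_zero, norm_le_zero_iff] at this
        exact sub_eq_zero.1 this
      simp [this, hC0]
    · rw [hG, ENNReal.mul_top (by simpa using hC0), add_top, ENNReal.mul_top (by simpa using hpos)]
      exact le_top
  · set G := (gradSup f θ₀ Θ₀ y).toReal with hGdef
    have hbd : ∀ t ∈ Θ₀, ∑ j, |pd f j t y| ≤ f θ₀ y * G := by
      intro t ht
      have h1 : ∑ j, ‖pd f j t y / f θ₀ y‖ₑ ≤ gradSup f θ₀ Θ₀ y :=
        Finset.sum_le_sum fun j _ => le_biSup (fun t => ‖pd f j t y / f θ₀ y‖ₑ) ht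
      have h2 := ENNReal.toReal_mono hG h1
      rw [ENNReal.toReal_sum (by simp)] at h2
      simp only [toReal_enorm, Real.norm_eq_abs, abs_div, abs_of_pos hpos] at h2
      rw [← Finset.sum_div, div_le_iff₀ hpos] at h2
      linarith
    have hmv := M.convex.norm_image_sub_le_of_norm_hasFDerivWithin_le (C := f θ₀ y * G)
      (fun t ht => (M.hasFDerivAt ht y).hasFDerivWithinAt) (fun t ht => by
        refine ContinuousLinearMap.opNorm_le_bound _ (by positivity) fun w => ?_
        refine (abs_apply_le_norm_mul_sum _ w).trans ?_
        rw [mul_comm]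
        gcongr
        exact hbd t ht) M.mem hθ
    have hle : f θ y ≤ f θ₀ y * (1 + C * G) := by
      have h1 := (abs_le.1 hmv).2
      have h2 : f θ₀ y * G * ‖θ - θ₀‖ ≤ f θ₀ y * G * C := by
        gcongr
        exact hC θ hθ
      linarith
    calc ENNReal.ofReal (f θ y) ≤ ENNReal.ofReal (f θ₀ y * (1 + C * G)) :=
          ENNReal.ofReal_le_ofReal hle
      _ = _ := by
        rw [ENNReal.ofReal_mul hpos.le, ENNReal.ofReal_add one_pos.le (by positivity),
          ENNReal.ofReal_mul C.coe_nonneg, ENNReal.ofReal_one, hGdef, ENNReal.ofReal_toReal hG,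
          ENNReal.ofReal_coe_nnreal]

theorem law_le (M : RegularModel f θ₀ Θ₀) {C : ℝ≥0} (hC : ∀ θ ∈ Θ₀, ‖θ - θ₀‖ ≤ C)
    (hθ : θ ∈ Θ₀) {B : Set (EuclideanSpace ℝ (Fin d))} (hB : MeasurableSet B) :
    law (f θ) B ≤ ∫⁻ y in B, (1 + C * gradSup f θ₀ Θ₀ y) ∂law (f θ₀) := by
  have hm : Measurable fun y => 1 + C * gradSup f θ₀ Θ₀ y :=
    measurable_const.add (M.measurable_gradSup.const_mul _)
  rw [law_apply hB, M.setLIntegral_law hm hB]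
  exact lintegral_mono_ae (ae_restrict_of_ae (M.density_le hC hθ))

theorem exists_norm_sub_le (M : RegularModel f θ₀ Θ₀) :
    ∃ C : ℝ≥0, ∀ θ ∈ Θ₀, ‖θ - θ₀‖ ≤ C := by
  obtain ⟨C, hC⟩ := M.compact.exists_bound_of_continuousOn (f := fun θ => θ - θ₀) (by fun_prop)
  exact ⟨C.toNNReal, fun θ hθ => (hC θ hθ).trans (Real.le_coe_toNNReal C)⟩

/-- A Gronwall type bound: if `∫_B |∇ f_t| ≤ S P_t(B)` for all `t`, then `P_t(B)` can decrease by
an exponential factor at most. -/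
theorem law_real_le_exp_mul (M : RegularModel f θ₀ Θ₀) {C : ℝ≥0} (hC : ∀ θ ∈ Θ₀, ‖θ - θ₀‖ ≤ C)
    (hθ : θ ∈ Θ₀) (x : EuclideanSpace ℝ (Fin d)) (r : ℝ) {S : ℝ}
    (hS : ∀ t ∈ Θ₀, ∑ j, ∫ y in Metric.closedBall x r, |pd f j t y| ≤
      S * (law (f t)).real (Metric.closedBall x r)) :
    (law (f θ₀)).real (Metric.closedBall x r) ≤
      Real.exp (C * S) * (law (f θ)).real (Metric.closedBall x r) := by
  set B := Metric.closedBall x r with hB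
  let γ : ℝ → EuclideanSpace ℝ (Fin q) := fun s => θ₀ + s • (θ - θ₀)
  have hγ : ∀ s ∈ Set.Icc (0 : ℝ) 1, γ s ∈ Θ₀ := fun s hs =>
    M.convex.add_smul_sub_mem M.mem hθ hs
  have hγ' : ∀ s, HasDerivAt γ (θ - θ₀) s := fun s => by
    have := ((hasDerivAt_id s).smul_const (θ - θ₀)).const_add θ₀
    rwa [one_smul] at this
  have hγc : Continuous γ := by fun_prop
  let w : ℝ → ℝ := fun s => ∫ y in B, f (γ s) y
  let F' : ℝ → EuclideanSpace ℝ (Fin d) → ℝ := fun s y =>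
    fderiv ℝ (fun t => f t y) (γ s) (θ - θ₀)
  have hF'bd : ∀ s ∈ Set.Icc (0 : ℝ) 1, ∀ y, |F' s y| ≤ C * ∑ j, |pd f j (γ s) y| := by
    intro s hs y
    refine (abs_apply_le_norm_mul_sum _ _).trans ?_
    exact mul_le_mul_of_nonneg_right (hC θ hθ) (Finset.sum_nonneg fun j _ => abs_nonneg _)
  choose c hc0 hc using fun j => exists_norm_le_of_continuousOn M.compact
    (M.smooth.continuousOn_pd j) x r
  -- Differentiation under the integral is carried out only for `0 < s < 1`, so continuity up to the
  -- endpoints is obtained separately.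
  have hwcont : ContinuousOn w (Set.Icc 0 1) := by
    obtain ⟨c₀, -, hc₀⟩ := exists_norm_le_of_continuousOn M.compact M.smooth.continuousOn x r
    refine continuousOn_of_dominated (bound := fun _ => c₀) ?_ ?_ ?_ ?_
    · exact fun s hs => (M.continuous_density (hγ s hs)).aestronglyMeasurable
    · intro s hs
      filter_upwards [ae_restrict_mem Metric.isClosed_closedBall.measurableSet] with y hy
      exact hc₀ _ (hγ s hs) y hy
    · exact integrableOn_const measure_closedBall_lt_top.ne
    · exact Eventually.of_forall fun y =>
        (continuousOn_param M.smooth.continuousOn y).comp hγc.continuousOn hγ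
  have hderiv : ∀ s ∈ Set.Ioo (0 : ℝ) 1, Integrable (F' s) (volume.restrict B) ∧
      HasDerivAt w (∫ y in B, F' s y) s := by
    intro s hs
    have hd : ∀ s ∈ Set.Ioo (0 : ℝ) 1, ∀ y, HasDerivAt (fun s => f (γ s) y) (F' s y) s :=
      fun s hs y => (M.hasFDerivAt (hγ s ⟨hs.1.le, hs.2.le⟩) y).comp_hasDerivAt s (hγ' s)
    have hIoo : Set.Ioo (0 : ℝ) 1 ∈ 𝓝 s := Ioo_mem_nhds hs.1 hs.2
    refine hasDerivAt_integral_of_dominated_loc_of_deriv_le (bound := fun _ => C * ∑ j, c j)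
      hIoo ?_ ?_ ?_ ?_ ?_ ?_
    · filter_upwards [hIoo] with s hs
      exact (M.continuous_density (hγ s ⟨hs.1.le, hs.2.le⟩)).aestronglyMeasurable
    · exact M.integrableOn_density (hγ s ⟨hs.1.le, hs.2.le⟩) x r
    · have hF'sum : F' s = fun y => ∑ j, (θ - θ₀) j * pd f j (γ s) y := by
        funext y
        have hw : θ - θ₀ = ∑ j, (θ - θ₀) j • EuclideanSpace.single j (1 : ℝ) := by
          simpa using ((EuclideanSpace.basisFun (Fin q) ℝ).sum_repr (θ - θ₀)).symm
        simp only [F']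
        conv_lhs => rw [hw, map_sum]
        exact Finset.sum_congr rfl fun j _ => by rw [map_smul, smul_eq_mul]; rfl
      rw [hF'sum]
      refine Continuous.aestronglyMeasurable (continuous_finsetSum _ fun j _ => ?_)
      exact continuous_const.mul (M.continuous_pd (hγ s ⟨hs.1.le, hs.2.le⟩) j)
    · filter_upwards [ae_restrict_mem Metric.isClosed_closedBall.measurableSet] with y hy s hs
      have hs' : s ∈ Set.Icc (0 : ℝ) 1 := ⟨hs.1.le, hs.2.le⟩
      refine (hF'bd s hs' y).trans ?_
      gcongr with j
      exact hc j _ (hγ s hs') y hy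
    · exact integrableOn_const measure_closedBall_lt_top.ne
    · exact Eventually.of_forall fun y s hs => hd s hs y
  have hw' : ∀ s ∈ Set.Ioo (0 : ℝ) 1, -(C * S * w s) ≤ ∫ y in B, F' s y := by
    intro s hs
    have hs' : s ∈ Set.Icc (0 : ℝ) 1 := ⟨hs.1.le, hs.2.le⟩
    have hi : ∀ j, Integrable (fun y => |pd f j (γ s) y|) (volume.restrict B) := fun j =>
      (M.continuous_pd (hγ s hs') j).abs.continuousOn.integrableOn_compact
        (isCompact_closedBall _ _)
    have h1 : |∫ y in B, F' s y| ≤ ∫ y in B, C * ∑ j, |pd f j (γ s) y| :=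
      norm_integral_le_of_norm_le (f := F' s)
        ((integrable_finsetSum Finset.univ fun j _ => hi j).const_mul _)
        (Eventually.of_forall fun y => hF'bd s hs' y)
    rw [integral_const_mul, integral_finsetSum _ fun j _ => hi j] at h1
    have h2 := hS _ (hγ s hs')
    rw [M.law_real_closedBall (hγ s hs')] at h2
    have h3 : (C : ℝ) * ∑ j, ∫ y in B, |pd f j (γ s) y| ≤ C * (S * w s) :=
      mul_le_mul_of_nonneg_left h2 C.2
    have h4 := (abs_le.1 h1).1
    linarith
  -- From `w' ≥ -C S w`, the integrating factor `exp(C S s)` makes the product non-decreasing;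
  -- comparing `s = 0` with `s = 1` gives the claim.
  have hmono : MonotoneOn (fun s => Real.exp (C * S * s) * w s) (Set.Icc 0 1) := by
    have hder : ∀ s ∈ Set.Ioo (0 : ℝ) 1, HasDerivAt (fun s => Real.exp (C * S * s) * w s)
        (Real.exp (C * S * s) * (C * S) * w s + Real.exp (C * S * s) * ∫ y in B, F' s y) s := by
      intro s hs
      have := ((hasDerivAt_id s).const_mul (C * S : ℝ)).exp.mul (hderiv s hs).2
      rw [mul_one] at this
      exact this
    refine monotoneOn_of_deriv_nonneg (convex_Icc _ _) ?_ ?_ ?_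
    · exact (by fun_prop : Continuous fun s : ℝ => Real.exp (C * S * s)).continuousOn.mul hwcont
    · rw [interior_Icc]
      exact fun s hs => (hder s hs).differentiableAt.differentiableWithinAt
    · rw [interior_Icc]
      intro s hs
      rw [(hder s hs).deriv]
      nlinarith [hw' s hs, Real.exp_pos (C * S * s)]
  have h01 := hmono (Set.left_mem_Icc.2 zero_le_one) (Set.right_mem_Icc.2 zero_le_one) zero_le_one
  rw [M.law_real_closedBall M.mem, M.law_real_closedBall hθ]
  simpa [w, γ] using h01

end RegularModel

end GMSP

namespace GMSP

/-! ### The functions of the ball and their bounds -/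

variable {d q : ℕ}

/-- `ψ_n` as a function of the centre and the radius of the ball. -/
noncomputable def ballPsi (h : ℝ → ℝ) (f : EuclideanSpace ℝ (Fin q) → EuclideanSpace ℝ (Fin d) → ℝ)
    (n : ℕ) (θ : EuclideanSpace ℝ (Fin q)) (p : EuclideanSpace ℝ (Fin d) × ℝ) :
    EuclideanSpace ℝ (Fin q) :=
  (v h (n * (law (f θ)).real (Metric.closedBall p.1 p.2)) *
    ((law (f θ)).real (Metric.closedBall p.1 p.2))⁻¹) •
      ∫ y in Metric.closedBall p.1 p.2, grad f θ y

/-- The supremum of the `j`-th score over a ball, as a function of the centre and the radius. -/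
noncomputable def ballScore (f : EuclideanSpace ℝ (Fin q) → EuclideanSpace ℝ (Fin d) → ℝ)
    (Θ₀ : Set (EuclideanSpace ℝ (Fin q))) (j : Fin q) (p : EuclideanSpace ℝ (Fin d) × ℝ) : ℝ≥0∞ :=
  ⨆ θ ∈ Θ₀, (∫⁻ y in Metric.closedBall p.1 p.2, ‖pd f j θ y‖ₑ) /
    law (f θ) (Metric.closedBall p.1 p.2)

variable {f : EuclideanSpace ℝ (Fin q) → EuclideanSpace ℝ (Fin d) → ℝ}
  {θ₀ θ : EuclideanSpace ℝ (Fin q)} {Θ₀ : Set (EuclideanSpace ℝ (Fin q))}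

theorem norm_le_sum_norm (w : EuclideanSpace ℝ (Fin q)) : ‖w‖ ≤ ∑ j, ‖w j‖ := by
  have hw : w = ∑ j, w j • EuclideanSpace.single j (1 : ℝ) := by
    simpa using ((EuclideanSpace.basisFun (Fin q) ℝ).sum_repr w).symm
  conv_lhs => rw [hw]
  refine (norm_sum_le _ _).trans (Finset.sum_le_sum fun j _ => ?_)
  simp [norm_smul]

theorem measurable_integral_closedBall {E F : Type*} [PseudoMetricSpace E]
    [SecondCountableTopology E] [MeasurableSpace E] [BorelSpace E] [NormedAddCommGroup F]
    [NormedSpace ℝ F] (Q : Measure E) [SFinite Q] {φ : E → F} (hφ : StronglyMeasurable φ) :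
    StronglyMeasurable fun p : E × ℝ => ∫ y in Metric.closedBall p.1 p.2, φ y ∂Q := by
  have hs : MeasurableSet {p : (E × ℝ) × E | dist p.2 p.1.1 ≤ p.1.2} :=
    measurableSet_le (by fun_prop) (by fun_prop)
  have h := StronglyMeasurable.integral_prod_right' (ν := Q)
    ((hφ.comp_measurable (measurable_snd (α := E × ℝ))).indicator hs)
  convert h using 2 with p
  rw [← integral_indicator Metric.isClosed_closedBall.measurableSet]
  rfl

namespace RegularModel

theorem measurable_ballPsi (M : RegularModel f θ₀ Θ₀) (hθ : θ ∈ Θ₀) (h : ℝ → ℝ) (n : ℕ) :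
    StronglyMeasurable (ballPsi h f n θ) := by
  have := (M.density θ hθ).isProbabilityMeasure_law
  have hl : Measurable fun p : EuclideanSpace ℝ (Fin d) × ℝ =>
      (law (f θ)).real (Metric.closedBall p.1 p.2) :=
    (measurable_measure_closedBall _).ennreal_toReal
  have hv : Measurable (v h) := (measurable_deriv h).mul measurable_id
  exact ((hv.comp (hl.const_mul _)).mul hl.inv).stronglyMeasurable.smul
    (measurable_integral_closedBall _ (M.continuous_grad hθ).stronglyMeasurable)

theorem continuousOn_law_closedBall (M : RegularModel f θ₀ Θ₀) (x : EuclideanSpace ℝ (Fin d))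
    (r : ℝ) : ContinuousOn (fun θ => law (f θ) (Metric.closedBall x r)) Θ₀ :=
  (continuousOn_setLIntegral_enorm M.compact M.smooth.continuousOn x r).congr fun _ hθ =>
    M.law_apply_enorm hθ Metric.isClosed_closedBall.measurableSet

theorem law_closedBall_ne_top (M : RegularModel f θ₀ Θ₀) (hθ : θ ∈ Θ₀)
    (B : Set (EuclideanSpace ℝ (Fin d))) : law (f θ) B ≠ ∞ := by
  have := (M.density θ hθ).isProbabilityMeasure_law
  exact measure_ne_top _ _

theorem measurable_ballScore (M : RegularModel f θ₀ Θ₀) (j : Fin q) :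
    Measurable (ballScore f Θ₀ j) := by
  obtain ⟨D, hD, hDc, hcl⟩ := exists_countable_subset_closure Θ₀
  have heq : ballScore f Θ₀ j = fun p => ⨆ θ ∈ D,
      (∫⁻ y in Metric.closedBall p.1 p.2, ‖pd f j θ y‖ₑ) /
        law (f θ) (Metric.closedBall p.1 p.2) := by
    funext p
    exact biSup_div_eq_of_subset_closure hD hcl
      (continuousOn_setLIntegral_enorm M.compact (M.smooth.continuousOn_pd j) p.1 p.2)
      (M.continuousOn_law_closedBall p.1 p.2) fun θ hθ => M.law_closedBall_ne_top hθ _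
  rw [heq]
  refine Measurable.biSup D hDc fun θ hθ => ?_
  have := (M.density θ (hD hθ)).isProbabilityMeasure_law
  exact (measurable_setLIntegral_closedBall _ (M.continuous_pd (hD hθ) j).enorm.measurable).div
    (measurable_measure_closedBall _)

theorem gradMass_div_le (hθ : θ ∈ Θ₀) (p : EuclideanSpace ℝ (Fin d) × ℝ) :
    gradMass f θ (Metric.closedBall p.1 p.2) / law (f θ) (Metric.closedBall p.1 p.2) ≤
      ∑ j, ballScore f Θ₀ j p := by
  rw [gradMass, div_eq_mul_inv, Finset.sum_mul]
  refine Finset.sum_le_sum fun j _ => ?_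
  rw [← div_eq_mul_inv]
  exact le_biSup (fun θ => (∫⁻ y in Metric.closedBall p.1 p.2, ‖pd f j θ y‖ₑ) /
    law (f θ) (Metric.closedBall p.1 p.2)) hθ

theorem enorm_integral_grad_le (M : RegularModel f θ₀ Θ₀) (hθ : θ ∈ Θ₀)
    (B : Set (EuclideanSpace ℝ (Fin d))) : ‖∫ y in B, grad f θ y‖ₑ ≤ gradMass f θ B := by
  refine (enorm_integral_le_lintegral_enorm _).trans ?_
  rw [gradMass, ← lintegral_finsetSum _ fun j _ => (M.continuous_pd hθ j).enorm.measurable]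
  refine lintegral_mono fun y => ?_
  simp_rw [← ofReal_norm]
  rw [← ENNReal.ofReal_sum_of_nonneg fun _ _ => norm_nonneg _]
  exact ENNReal.ofReal_le_ofReal (norm_le_sum_norm _)

/-- Put `z = n P_θ(B)` in the bound for `v`: the constant term leaves the score, while in the terms
`z + z²` the factor `P_θ(B)⁻¹` cancels. If `P_θ(B) = 0`, the left side is `0` by the convention for
the inverse. -/
theorem enorm_ballPsi_le (M : RegularModel f θ₀ Θ₀) (hθ : θ ∈ Θ₀) {h : ℝ → ℝ} {C c₀ : ℝ≥0}
    (hv : ∀ z, 0 < z → |v h z| ≤ C * (c₀ + z + z ^ 2)) {n : ℕ} (hn : n ≠ 0)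
    (p : EuclideanSpace ℝ (Fin d) × ℝ) :
    ‖ballPsi h f n θ p‖ₑ ≤ C * (c₀ * ∑ j, ballScore f Θ₀ j p +
      n * gradMass f θ (Metric.closedBall p.1 p.2) *
        (1 + n * law (f θ) (Metric.closedBall p.1 p.2))) := by
  set B := Metric.closedBall p.1 p.2 with hB
  set a := gradMass f θ B with ha
  set b := law (f θ) B with hb
  have hbt : b ≠ ∞ := M.law_closedBall_ne_top hθ B
  rcases eq_or_ne b 0 with h0 | h0
  · have : (law (f θ)).real B = 0 := by simp [Measure.real, ← hb, h0]
    simp [ballPsi, ← hB, this]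
  have hpos : 0 < (law (f θ)).real B := ENNReal.toReal_pos h0 hbt
  have hbr : ENNReal.ofReal ((law (f θ)).real B) = b := ENNReal.ofReal_toReal hbt
  have hzpos : 0 < n * (law (f θ)).real B := by positivity
  have h1 : ‖v h (n * (law (f θ)).real B)‖ₑ ≤ C * (c₀ + n * b + (n * b) ^ 2) := by
    rw [Real.enorm_eq_ofReal_abs]
    refine (ENNReal.ofReal_le_ofReal (hv _ hzpos)).trans_eq ?_
    have hz : ENNReal.ofReal (n * (law (f θ)).real B) = n * b := by
      rw [ENNReal.ofReal_mul (by positivity), hbr, ENNReal.ofReal_natCast]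
    rw [ENNReal.ofReal_mul C.coe_nonneg, ENNReal.ofReal_add (by positivity) (by positivity),
      ENNReal.ofReal_add (by positivity) (by positivity), ENNReal.ofReal_pow (by positivity), hz,
      ENNReal.ofReal_coe_nnreal, ENNReal.ofReal_coe_nnreal]
  have h2 : ‖((law (f θ)).real B)⁻¹‖ₑ = b⁻¹ := by
    rw [Real.enorm_of_nonneg (by positivity), ENNReal.ofReal_inv_of_pos hpos, hbr]
  have hS : a / b ≤ ∑ j, ballScore f Θ₀ j p := gradMass_div_le hθ p
  calc ‖ballPsi h f n θ p‖ₑ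
      = ‖v h (n * (law (f θ)).real B)‖ₑ * b⁻¹ * ‖∫ y in B, grad f θ y‖ₑ := by
        rw [ballPsi, enorm_smul, enorm_mul, h2]
    _ ≤ C * (c₀ + n * b + (n * b) ^ 2) * b⁻¹ * a := by
        gcongr
        exact M.enorm_integral_grad_le hθ B
    _ = C * (c₀ * (a / b) + n * a * (b * b⁻¹) * (1 + n * b)) := by
        rw [div_eq_mul_inv]
        ring
    _ = C * (c₀ * (a / b) + n * a * (1 + n * b)) := by rw [ENNReal.mul_inv_cancel h0 hbt, mul_one]
    _ ≤ _ := by gcongr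

/-- Cauchy–Schwarz against the constant `1` on the ball. -/
theorem sq_couplingAverage_le {E : Type*} [MetricSpace E] [SecondCountableTopology E]
    [MeasurableSpace E] [BorelSpace E] {P : Measure E} [IsProbabilityMeasure P] {n : ℕ}
    {φ : E → ℝ≥0∞} (hφ : Measurable φ) {p : E × ℝ}
    (hp : P (Metric.closedBall p.1 (couplingRadius P n p)) ≠ 0) :
    couplingAverage P n φ p ^ 2 ≤ couplingAverage P n (fun y => φ y ^ 2) p := by
  simp only [couplingAverage]
  set B := Metric.closedBall p.1 (couplingRadius P n p)
  have h := ENNReal.lintegral_mul_le_Lp_mul_Lq (P.restrict B) Real.HolderConjugate.two_two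
    hφ.aemeasurable (aemeasurable_const (b := (1 : ℝ≥0∞)))
  simp only [Pi.mul_apply, mul_one, ENNReal.one_rpow, lintegral_const, Measure.restrict_apply_univ,
    one_mul] at h
  have hsq : ∀ a : ℝ≥0∞, (a ^ (1 / 2 : ℝ)) ^ 2 = a := by
    intro a
    rw [← ENNReal.rpow_two, ← ENNReal.rpow_mul]
    norm_num
  have h2 : (∫⁻ y in B, φ y ∂P) ^ 2 ≤ (∫⁻ y in B, φ y ^ 2 ∂P) * P B := by
    calc _ ≤ _ := pow_le_pow_left' h 2
      _ = _ := by rw [mul_pow, hsq, hsq]; simp only [ENNReal.rpow_two]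
  calc ((P B)⁻¹ * ∫⁻ y in B, φ y ∂P) ^ 2 = (P B)⁻¹ ^ 2 * (∫⁻ y in B, φ y ∂P) ^ 2 := mul_pow _ _ _
    _ ≤ (P B)⁻¹ ^ 2 * ((∫⁻ y in B, φ y ^ 2 ∂P) * P B) := by gcongr
    _ = (P B)⁻¹ * (∫⁻ y in B, φ y ^ 2 ∂P) * ((P B)⁻¹ * P B) := by ring
    _ = _ := by rw [ENNReal.inv_mul_cancel hp (measure_ne_top _ _), mul_one]

/-- `1 - exp(-s) ≤ s`, and the factor `2` bounds `n / (n - 1)` for `n ≥ 2`. -/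
theorem couplingMass_le {n : ℕ} (hn : 2 ≤ n) {t : ℝ} (ht : 0 < t) :
    n * (1 - Real.exp (-(t / ((n : ℝ) - 1)))) ≤ 2 * t := by
  have h2 : (2 : ℝ) ≤ n := by exact_mod_cast hn
  have hn' : (0 : ℝ) < n - 1 := by linarith
  have h1 := Real.add_one_le_exp (-(t / ((n : ℝ) - 1)))
  have h3 : (n : ℝ) * (t / (n - 1)) ≤ 2 * t := by
    rw [← mul_div_assoc, div_le_iff₀ hn']
    nlinarith
  nlinarith

/-- The domination of the part of `ψ_n` that does not involve the scores: both masses are compared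
with averages under the true law. -/
theorem mul_gradMass_mul_le (hd : 0 < d) (M : RegularModel f θ₀ Θ₀) {D : ℝ≥0}
    (hD : ∀ θ ∈ Θ₀, ‖θ - θ₀‖ ≤ D) (hθ : θ ∈ Θ₀) {n : ℕ} (hn : 2 ≤ n)
    (x : EuclideanSpace ℝ (Fin d)) {t : ℝ} (ht : 0 < t) :
    n * gradMass f θ (Metric.closedBall x (couplingRadius (law (f θ₀)) n (x, t))) *
        (1 + n * law (f θ) (Metric.closedBall x (couplingRadius (law (f θ₀)) n (x, t)))) ≤
      (1 + D) * (ENNReal.ofReal ((1 + 2 * t) ^ 2) *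
        couplingAverage (law (f θ₀)) n (fun y => (1 + gradSup f θ₀ Θ₀ y) ^ 2) (x, t)) := by
  have := (M.density θ₀ M.mem).isProbabilityMeasure_law
  have hP := law_sphere hd (f θ₀)
  set P := law (f θ₀)
  set B := Metric.closedBall x (couplingRadius P n (x, t)) with hB
  have hBm : MeasurableSet B := Metric.isClosed_closedBall.measurableSet
  set L := couplingAverage P n (fun y => 1 + gradSup f θ₀ Θ₀ y) (x, t) with hL
  have hPB : P B = ENNReal.ofReal (1 - Real.exp (-(t / ((n : ℝ) - 1)))) :=
    measure_closedBall_couplingRadius hP hn ht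
  have hPB0 : P B ≠ 0 := by
    rw [hPB]
    simpa using couplingMass_pos hn ht
  have hPBt : P B ≠ ∞ := measure_ne_top _ _
  have hint : ∫⁻ y in B, (1 + gradSup f θ₀ Θ₀ y) ∂P = P B * L := by
    rw [hL, couplingAverage, ← mul_assoc, ENNReal.mul_inv_cancel hPB0 hPBt, one_mul]
  have ha : gradMass f θ B ≤ P B * L := by
    rw [← hint]
    exact (M.gradMass_le hθ hBm).trans (lintegral_mono fun y => le_add_self)
  have hb : law (f θ) B ≤ (1 + D) * (P B * L) := by
    rw [← hint, ← lintegral_const_mul' _ _ (by finiteness)]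
    refine (M.law_le hD hθ hBm).trans (lintegral_mono fun y => ?_)
    calc 1 + D * gradSup f θ₀ Θ₀ y ≤ 1 + D * gradSup f θ₀ Θ₀ y + (D + gradSup f θ₀ Θ₀ y) :=
          le_self_add
      _ = (1 + D) * (1 + gradSup f θ₀ Θ₀ y) := by ring
  -- The `1` in `1 + gradSup` serves this: it makes the bound homogeneous of degree two in `L`.
  have hL1 : 1 ≤ L := by
    rw [hL, couplingAverage]
    calc (1 : ℝ≥0∞) = (P B)⁻¹ * ∫⁻ _y in B, 1 ∂P := by
          rw [setLIntegral_const, one_mul, ENNReal.inv_mul_cancel hPB0 hPBt]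
      _ ≤ _ := by
          gcongr with y
          exact le_self_add
  have hW : 1 + n * P B ≤ ENNReal.ofReal (1 + 2 * t) := by
    rw [hPB, ENNReal.ofReal_add one_pos.le (by positivity), ENNReal.ofReal_one,
      ← ENNReal.ofReal_natCast, ← ENNReal.ofReal_mul (by positivity)]
    exact add_le_add_right (ENNReal.ofReal_le_ofReal (couplingMass_le hn ht)) 1
  calc n * gradMass f θ B * (1 + n * law (f θ) B)
      ≤ n * (P B * L) * (L + n * ((1 + D) * (P B * L))) := by gcongr
    -- The added terms are exactly those missing from the expansion of `(1 + D) (1 + n P(B))² L²`.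
    _ ≤ n * (P B * L) * (L + n * ((1 + D) * (P B * L))) +
          (1 + D + n * P B + 2 * (D * (n * P B))) * L ^ 2 := le_self_add
    _ = (1 + D) * ((1 + n * P B) ^ 2 * L ^ 2) := by ring
    _ ≤ (1 + D) * (ENNReal.ofReal (1 + 2 * t) ^ 2 *
          couplingAverage P n (fun y => (1 + gradSup f θ₀ Θ₀ y) ^ 2) (x, t)) := by
        gcongr
        exact sq_couplingAverage_le (measurable_const.add M.measurable_gradSup) hPB0
    _ = _ := by rw [ENNReal.ofReal_pow (by positivity)]

end RegularModel

end GMSP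

namespace GMSP

/-! ### Pointwise convergence -/

/-- With `s = t/(n-1)`, squeeze by `1 - 1/(1+s) ≤ 1 - exp(-s) ≤ s`; the two bounds are `t n/(n+t-1)`
and `t n/(n-1)`. -/
theorem tendsto_couplingMass {n : ℕ → ℕ} (hn2 : ∀ k, 2 ≤ n k) (hn : Tendsto n atTop atTop) {t : ℝ}
    (ht : 0 < t) :
    Tendsto (fun k => n k * (1 - Real.exp (-(t / ((n k : ℝ) - 1))))) atTop (𝓝 t) := by
  have h1 : Tendsto (fun m : ℕ => t * ((m : ℝ) / (m + (-1)))) atTop (𝓝 t) := by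
    simpa using (tendsto_natCast_div_add_atTop (𝕜 := ℝ) (-1)).const_mul t
  have h2 : Tendsto (fun m : ℕ => t * ((m : ℝ) / (m + (t - 1)))) atTop (𝓝 t) := by
    simpa using (tendsto_natCast_div_add_atTop (𝕜 := ℝ) (t - 1)).const_mul t
  refine tendsto_of_tendsto_of_tendsto_of_le_of_le (h2.comp hn) (h1.comp hn) (fun k => ?_)
    fun k => ?_
  all_goals
    have hk : (2 : ℝ) ≤ n k := by exact_mod_cast hn2 k
    have hk' : (0 : ℝ) < n k - 1 := by linarith
    simp only [Function.comp_apply]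
    set s := t / ((n k : ℝ) - 1) with hs
    have hs0 : 0 < s := div_pos ht hk'
    have hst : t = s * (n k - 1) := by rw [hs, div_mul_cancel₀ _ hk'.ne']
  · have h3 : Real.exp (-s) ≤ (1 + s)⁻¹ := by
      rw [Real.exp_neg]
      exact inv_anti₀ (by positivity) (by linarith [Real.add_one_le_exp s])
    have h4 : t * ((n k : ℝ) / (n k + (t - 1))) = n k * (1 - (1 + s)⁻¹) := by
      have h5 : (n k : ℝ) + (t - 1) = (n k - 1) * (1 + s) := by
        rw [hst]
        ring
      rw [h5, hst]
      field_simp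
      ring
    rw [h4]
    gcongr
  · have h4 : t * ((n k : ℝ) / (n k + -1)) = n k * s := by
      rw [hs]
      ring
    rw [h4]
    gcongr
    linarith [Real.add_one_le_exp (-s)]

variable {d q : ℕ} {f : EuclideanSpace ℝ (Fin q) → EuclideanSpace ℝ (Fin d) → ℝ}
  {θ₀ θ : EuclideanSpace ℝ (Fin q)} {Θ₀ : Set (EuclideanSpace ℝ (Fin q))}

namespace RegularModel

/-- Since `g` is continuous and positive at `x`, each ball around `x` has positive mass, whereas the
mass of the coupling balls tends to `0`. -/
theorem tendsto_couplingRadius (hd : 0 < d) (M : RegularModel f θ₀ Θ₀) {n : ℕ → ℕ}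
    (hn2 : ∀ k, 2 ≤ n k) (hn : Tendsto n atTop atTop) {x : EuclideanSpace ℝ (Fin d)}
    (hx : 0 < f θ₀ x) {t : ℝ} (ht : 0 < t) :
    Tendsto (fun k => couplingRadius (law (f θ₀)) (n k) (x, t)) atTop (𝓝 0) := by
  have := (M.density θ₀ M.mem).isProbabilityMeasure_law
  have hP := law_sphere hd (f θ₀)
  have hu : Tendsto (fun k => 1 - Real.exp (-(t / ((n k : ℝ) - 1)))) atTop (𝓝 0) := by
    have h1 := (tendsto_couplingMass hn2 hn ht).mul
      ((tendsto_inv_atTop_nhds_zero_nat (𝕜 := ℝ)).comp hn)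
    rw [mul_zero] at h1
    refine h1.congr fun k => ?_
    have : (n k : ℝ) ≠ 0 := by
      have := hn2 k
      positivity
    simp only [Function.comp_apply]
    field_simp
  rw [Metric.tendsto_atTop']
  intro ε hε
  have hmass : 0 < (law (f θ₀)).real (Metric.closedBall x (ε / 2)) := by
    rw [M.law_real_closedBall M.mem]
    have hpos : 0 < ∫ y in Metric.ball x (ε / 2), f θ₀ y := by
      refine (integral_pos_iff_support_of_nonneg (M.density θ₀ M.mem).nonneg
        ((M.integrableOn_density M.mem x (ε / 2)).mono_set Metric.ball_subset_closedBall)).2 ?_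
      have hopen : IsOpen (Function.support (f θ₀)) :=
        (M.continuous_density M.mem).isOpen_support
      rw [Measure.restrict_apply hopen.measurableSet]
      refine (hopen.inter Metric.isOpen_ball).measure_pos _ ⟨x, hx.ne', ?_⟩
      exact Metric.mem_ball_self (by positivity)
    exact hpos.trans_le (setIntegral_mono_set (M.integrableOn_density M.mem x (ε / 2))
      (Eventually.of_forall (M.density θ₀ M.mem).nonneg)
      Metric.ball_subset_closedBall.eventuallyLE)
  obtain ⟨N, hN⟩ := eventually_atTop.1 (hu.eventually (ge_mem_nhds hmass))
  refine ⟨N, fun k hk => ?_⟩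
  have h1 := (couplingRadius_le_iff hP (hn2 k) ht (ε / 2)).2 (hN k hk.le)
  have h2 := couplingRadius_pos hP (hn2 k) ht (x := x)
  rw [Real.dist_eq, sub_zero, abs_of_pos h2]
  linarith

theorem tendsto_law_div_volume (M : RegularModel f θ₀ Θ₀)
    {s : ℕ → EuclideanSpace ℝ (Fin q)} (hs : ∀ k, s k ∈ Θ₀) (hθ : θ ∈ Θ₀)
    (hlim : Tendsto s atTop (𝓝 θ)) (x : EuclideanSpace ℝ (Fin d)) {r : ℕ → ℝ}
    (hr : ∀ k, 0 < r k) (hr0 : Tendsto r atTop (𝓝 0)) :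
    Tendsto (fun k => (volume.real (Metric.closedBall x (r k)))⁻¹ *
      (law (f (s k))).real (Metric.closedBall x (r k))) atTop (𝓝 (f θ x)) := by
  refine (tendsto_average_closedBall M.smooth.continuousOn hs hθ hlim x hr hr0).congr fun k => ?_
  rw [smul_eq_mul, M.law_real_closedBall (hs k)]

/-- `ψ_n` converges to `ψ` on the coupled space. -/
theorem tendsto_ballPsi (hd : 0 < d) (M : RegularModel f θ₀ Θ₀) {h : ℝ → ℝ} {C c₀ : ℝ≥0}
    (hv : ∀ z, 0 < z → |v h z| ≤ C * (c₀ + z + z ^ 2)) (hvc : ContinuousOn (v h) (Set.Ioi 0))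
    {n : ℕ → ℕ} (hn2 : ∀ k, 2 ≤ n k) (hn : Tendsto n atTop atTop)
    {s : ℕ → EuclideanSpace ℝ (Fin q)} (hs : ∀ k, s k ∈ Θ₀) (hθ : θ ∈ Θ₀)
    (hlim : Tendsto s atTop (𝓝 θ)) {x : EuclideanSpace ℝ (Fin d)} (hx : 0 < f θ₀ x) {t : ℝ}
    (ht : 0 < t) (hfx : c₀ ≠ 0 → f θ x ≠ 0) :
    Tendsto (fun k => ballPsi h f (n k) (s k) (x, couplingRadius (law (f θ₀)) (n k) (x, t))) atTop
      (𝓝 (psi h f θ₀ x t θ)) := by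
  have := (M.density θ₀ M.mem).isProbabilityMeasure_law
  have hP := law_sphere hd (f θ₀)
  set r := fun k => couplingRadius (law (f θ₀)) (n k) (x, t) with hr
  have hr0 : Tendsto r atTop (𝓝 0) := M.tendsto_couplingRadius hd hn2 hn hx ht
  have hrpos : ∀ k, 0 < r k := fun k => couplingRadius_pos hP (hn2 k) ht
  have hVpos : ∀ k, 0 < volume.real (Metric.closedBall x (r k)) := fun k =>
    ENNReal.toReal_pos (Metric.measure_closedBall_pos _ _ (hrpos k)).ne'
      measure_closedBall_lt_top.ne
  have hg := M.tendsto_law_div_volume (fun _ => M.mem) M.mem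
    (tendsto_const_nhds (x := θ₀) (f := (atTop : Filter ℕ))) x hrpos hr0
  have hp := M.tendsto_law_div_volume hs hθ hlim x hrpos hr0
  have hI := tendsto_average_closedBall M.continuousOn_grad hs hθ hlim x hrpos hr0
  have hu : Tendsto (fun k => n k * (law (f θ₀)).real (Metric.closedBall x (r k))) atTop (𝓝 t) := by
    refine (tendsto_couplingMass hn2 hn ht).congr fun k => ?_
    rw [hr, real_closedBall_couplingRadius hP (hn2 k) ht]
  have hu0 : ∀ k, 0 < (law (f θ₀)).real (Metric.closedBall x (r k)) := by
    intro k
    rw [hr, real_closedBall_couplingRadius hP (hn2 k) ht]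
    exact couplingMass_pos (hn2 k) ht
  have hz : Tendsto (fun k => n k * (law (f (s k))).real (Metric.closedBall x (r k))) atTop
      (𝓝 (t * (f θ x / f θ₀ x))) := by
    refine (hu.mul (hp.div hg hx.ne')).congr fun k => ?_
    have h1 := (hVpos k).ne'
    have h2 := (hu0 k).ne'
    simp only [Pi.div_apply]
    field_simp
  rcases eq_or_ne (f θ x) 0 with h0 | h0
  · have hc₀ : c₀ = 0 := by
      by_contra hc
      exact hfx hc h0
    have hgrad : grad f θ x = 0 := by
      ext j
      exact M.pd_eq_zero θ hθ x j h0
    have hpsi : psi h f θ₀ x t θ = 0 := by simp [psi, h0]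
    rw [hpsi]
    -- With `c₀ = 0` the scalar factor is at most `C n (1 + z)`. The rest, `n |∫_B ∇f|`, is written
    -- as `n P(B)` times volume over `P(B)` times the norm of the mean gradient, with limit `t ·
    -- g(x)⁻¹ · 0`.
    refine squeeze_zero_norm (a := fun k => C * (1 + n k * (law (f (s k))).real
      (Metric.closedBall x (r k))) * ((n k * (law (f θ₀)).real (Metric.closedBall x (r k))) *
      ((volume.real (Metric.closedBall x (r k)))⁻¹ * (law (f θ₀)).real
        (Metric.closedBall x (r k)))⁻¹ * ‖(volume.real (Metric.closedBall x (r k)))⁻¹ •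
          ∫ y in Metric.closedBall x (r k), grad f (s k) y‖)) (fun k => ?_) ?_
    · set P := (law (f (s k))).real (Metric.closedBall x (r k)) with hPdef
      have hV := hVpos k
      have hu0k := hu0 k
      have hPnn : 0 ≤ P := measureReal_nonneg
      have hnk : (0 : ℝ) < n k := by
        have := hn2 k
        positivity
      have hcalc : (n k * (law (f θ₀)).real (Metric.closedBall x (r k))) *
          ((volume.real (Metric.closedBall x (r k)))⁻¹ * (law (f θ₀)).real
            (Metric.closedBall x (r k)))⁻¹ * ‖(volume.real (Metric.closedBall x (r k)))⁻¹ •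
            ∫ y in Metric.closedBall x (r k), grad f (s k) y‖ =
          n k * ‖∫ y in Metric.closedBall x (r k), grad f (s k) y‖ := by
        rw [norm_smul, norm_inv, Real.norm_of_nonneg hV.le]
        field_simp
      rw [hcalc, ballPsi, norm_smul, norm_mul, norm_inv, ← hPdef, Real.norm_of_nonneg hPnn,
        ← mul_assoc]
      refine mul_le_mul_of_nonneg_right ?_ (norm_nonneg _)
      rcases hPnn.eq_or_lt with hP0 | hPpos
      · rw [← hP0]
        simp only [inv_zero, mul_zero]
        positivity
      · have := hv (n k * P) (by positivity)
        rw [hc₀, NNReal.coe_zero, zero_add] at this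
        rw [← div_eq_mul_inv, div_le_iff₀ hPpos, Real.norm_eq_abs]
        refine this.trans_eq ?_
        ring
    · have h1 := ((hz.const_add 1).const_mul (C : ℝ)).mul
        ((hu.mul (hg.inv₀ hx.ne')).mul hI.norm)
      simpa [hgrad] using h1
  · have hfpos : 0 < f θ x := lt_of_le_of_ne ((M.density θ hθ).nonneg x) (Ne.symm h0)
    have hzpos : 0 < t * (f θ x / f θ₀ x) := by positivity
    have hvz := (hvc.continuousAt (Ioi_mem_nhds hzpos)).tendsto.comp hz
    refine ((hvz.mul (hp.inv₀ h0)).smul hI).congr fun k => ?_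
    have hV := (hVpos k).ne'
    simp only [ballPsi, Function.comp_apply]
    rw [smul_smul]
    congr 1
    rw [mul_inv, inv_inv]
    field_simp
    rfl

/-! ### Uniform integrability on the coupled space -/

variable {Ω : Type*} [MeasurableSpace Ω] {μ : Measure Ω} [IsProbabilityMeasure μ]
  {ξ : ℕ → Ω → EuclideanSpace ℝ (Fin d)}

/-- The sum of the scores on the coupled space. -/
noncomputable def _root_.GMSP.couplingScore
    (f : EuclideanSpace ℝ (Fin q) → EuclideanSpace ℝ (Fin d) → ℝ) (θ₀ : EuclideanSpace ℝ (Fin q))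
    (Θ₀ : Set (EuclideanSpace ℝ (Fin q))) (n : ℕ) (p : EuclideanSpace ℝ (Fin d) × ℝ) : ℝ≥0∞ :=
  ∑ j, ballScore f Θ₀ j (p.1, couplingRadius (law (f θ₀)) n p)

theorem measurable_coupling (hd : 0 < d) (M : RegularModel f θ₀ Θ₀) {n : ℕ} (hn : 2 ≤ n) :
    Measurable fun p : EuclideanSpace ℝ (Fin d) × ℝ =>
      (p.1, couplingRadius (law (f θ₀)) n p) := by
  have := (M.density θ₀ M.mem).isProbabilityMeasure_law
  exact measurable_fst.prodMk (measurable_couplingRadius (law_sphere hd (f θ₀)) hn)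

theorem measurable_couplingScore (hd : 0 < d) (M : RegularModel f θ₀ Θ₀) {n : ℕ} (hn : 2 ≤ n) :
    Measurable (couplingScore f θ₀ Θ₀ n) :=
  Finset.measurable_fun_sum _ fun j _ =>
    (M.measurable_ballScore j).comp (M.measurable_coupling hd hn)

/-- Uniform integrability depends on the law of centre and radius only, so it passes to the coupled
space; `b n` collects each score on the event that it reaches its threshold. -/
theorem exists_couplingScore_dominated (hd : 0 < d) (M : RegularModel f θ₀ Θ₀)
    (hmeas : ∀ i, Measurable (ξ i)) (hindep : iIndepFun ξ μ)
    (hlaw : ∀ i, μ.map (ξ i) = law (f θ₀)) (hui : UnifIntScore μ ξ f Θ₀) {ε : ℝ≥0∞} (hε : 0 < ε) :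
    ∃ (K : ℝ≥0) (b : ℕ → EuclideanSpace ℝ (Fin d) × ℝ → ℝ≥0∞), ∀ n, 2 ≤ n →
      Measurable (b n) ∧ ∫⁻ p, b n p ∂limitLaw f θ₀ ≤ ε ∧
      ∀ p, couplingScore f θ₀ Θ₀ n p ≤ K + b n p := by
  have := (M.density θ₀ M.mem).isProbabilityMeasure_law
  have hP := law_sphere hd (f θ₀)
  -- For `q = 0` the quotient is `∞`, but then the sums are empty.
  have hεq : 0 < ε / q := ENNReal.div_pos hε.ne' (ENNReal.natCast_ne_top q)
  choose K hK using fun j => hui j (ε / q) hεq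
  let φ : Fin q → EuclideanSpace ℝ (Fin d) × ℝ → ℝ≥0∞ := fun j =>
    {p | (K j : ℝ≥0∞) ≤ ballScore f Θ₀ j p}.indicator (ballScore f Θ₀ j)
  have hset : ∀ j, MeasurableSet {p | (K j : ℝ≥0∞) ≤ ballScore f Θ₀ j p} := fun j =>
    measurableSet_le measurable_const (M.measurable_ballScore j)
  have hφ : ∀ j, Measurable (φ j) := fun j => (M.measurable_ballScore j).indicator (hset j)
  refine ⟨∑ j, K j, fun n p => ∑ j, φ j (p.1, couplingRadius (law (f θ₀)) n p), fun n hn => ?_⟩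
  have hm := M.measurable_coupling hd hn
  refine ⟨Finset.measurable_fun_sum _ fun j _ => (hφ j).comp hm, ?_, fun p => ?_⟩
  · have hmΩ : Measurable fun ω => (ξ 0 ω, nnRadius (fun i => ξ i ω) n 0) :=
      (hmeas 0).prodMk (measurable_nnRadius hmeas n)
    refine (lintegral_finsetSum Finset.univ fun j _ => (hφ j).comp hm).trans_le ?_
    simp only [Function.comp_apply]
    calc ∑ j, ∫⁻ p, φ j (p.1, couplingRadius (law (f θ₀)) n p) ∂limitLaw f θ₀
        ≤ ∑ _j : Fin q, ε / q := by
          refine Finset.sum_le_sum fun j _ => ?_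
          rw [limitLaw, ← lintegral_map (hφ j) hm, ← map_nnRadius_eq hP hmeas hindep hlaw hn,
            lintegral_map (hφ j) hmΩ]
          refine le_trans (le_of_eq ?_) (hK j n hn)
          exact lintegral_indicator (hmΩ (hset j))
            fun ω => ballScore f Θ₀ j (ξ 0 ω, nnRadius (fun i => ξ i ω) n 0)
      _ ≤ ε := by simpa using ENNReal.mul_div_le
  · rw [ENNReal.ofNNReal_finsetSum, ← Finset.sum_add_distrib]
    refine Finset.sum_le_sum fun j _ => ?_
    by_cases hle : (K j : ℝ≥0∞) ≤ ballScore f Θ₀ j (p.1, couplingRadius (law (f θ₀)) n p)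
    · simp only [φ]
      rw [Set.indicator_of_mem (by exact hle)]
      exact le_add_self
    · exact (not_le.1 hle).le.trans le_self_add

/-- Uniform integrability of the scores forces the densities to be positive where the true one
is. -/
theorem ae_ne_zero_of_unifIntScore (hd : 0 < d) (M : RegularModel f θ₀ Θ₀)
    (hmeas : ∀ i, Measurable (ξ i)) (hindep : iIndepFun ξ μ)
    (hlaw : ∀ i, μ.map (ξ i) = law (f θ₀)) (hui : UnifIntScore μ ξ f Θ₀) (hθ : θ ∈ Θ₀) :
    ∀ᵐ p ∂limitLaw f θ₀, f θ p.1 ≠ 0 := by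
  have := (M.density θ₀ M.mem).isProbabilityMeasure_law
  have := isProbabilityMeasure_expMeasure one_pos
  have hP := law_sphere hd (f θ₀)
  have hprob : IsProbabilityMeasure (limitLaw f θ₀) := by
    unfold limitLaw
    infer_instance
  obtain ⟨K, b, hb⟩ := M.exists_couplingScore_dominated hd hmeas hindep hlaw hui one_pos
  obtain ⟨D, hD⟩ := M.exists_norm_sub_le
  have hbound : ∀ n, ∫⁻ p, couplingScore f θ₀ Θ₀ (n + 2) p ∂limitLaw f θ₀ ≤ K + 1 := by
    intro n
    obtain ⟨h1, h2, h3⟩ := hb (n + 2) (by omega)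
    calc _ ≤ ∫⁻ p, K + b (n + 2) p ∂limitLaw f θ₀ := lintegral_mono h3
      _ = K + ∫⁻ p, b (n + 2) p ∂limitLaw f θ₀ := by
        rw [lintegral_add_left measurable_const, lintegral_const, measure_univ, mul_one]
      _ ≤ _ := by gcongr
  have hm : ∀ n, Measurable (couplingScore f θ₀ Θ₀ (n + 2)) := fun n =>
    M.measurable_couplingScore hd (by omega)
  -- By Fatou the limit inferior of the scores is finite almost everywhere, so at almost every point
  -- they stay below some `c` for infinitely many `n`.
  have hfin : ∫⁻ p, liminf (fun n => couplingScore f θ₀ Θ₀ (n + 2) p) atTop ∂limitLaw f θ₀ ≠ ∞ := by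
    refine ne_top_of_le_ne_top (b := (K : ℝ≥0∞) + 1) (by finiteness) ?_
    refine (lintegral_liminf_le hm).trans ?_
    refine (liminf_le_liminf (Eventually.of_forall hbound)).trans ?_
    simp
  have hpos1 : ∀ᵐ p ∂limitLaw f θ₀, 0 < f θ₀ p.1 :=
    Measure.quasiMeasurePreserving_fst.ae M.ae_pos
  have hpos2 : ∀ᵐ p ∂limitLaw f θ₀, 0 < p.2 := ae_pos_snd
  filter_upwards [ae_lt_top (Measurable.liminf hm) hfin, hpos1, hpos2] with p hp hx ht hfx
  obtain ⟨x, t⟩ := p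
  simp only at hx ht hfx
  obtain ⟨c, hc⟩ := ENNReal.lt_iff_exists_nnreal_btwn.1 hp
  have hfreq : ∃ᶠ n in atTop, couplingScore f θ₀ Θ₀ (n + 2) (x, t) < c :=
    frequently_lt_of_liminf_lt (by isBoundedDefault) hc.1
  set r := fun n : ℕ => couplingRadius (law (f θ₀)) (n + 2) (x, t) with hr
  have hr0 : Tendsto r atTop (𝓝 0) := M.tendsto_couplingRadius hd (n := fun n => n + 2)
    (fun n => by omega) (tendsto_add_atTop_nat 2) hx ht
  have hrpos : ∀ k, 0 < r k := fun k => couplingRadius_pos hP (by omega) ht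
  have hg := M.tendsto_law_div_volume (fun _ => M.mem) M.mem
    (tendsto_const_nhds (x := θ₀) (f := (atTop : Filter ℕ))) x hrpos hr0
  have hp := M.tendsto_law_div_volume (fun _ => hθ) hθ
    (tendsto_const_nhds (x := θ) (f := (atTop : Filter ℕ))) x hrpos hr0
  have hlim := (hp.const_mul (Real.exp (D * c))).sub hg
  -- For those `n` the Gronwall bound, divided by the volume of the ball, passes to the limit as
  -- `g(x) ≤ exp(D c) f_θ(x)`. This contradicts `f_θ(x) = 0`.
  have hge := ge_of_tendsto_of_frequently hlim (b := 0) (hfreq.mono fun n hn => ?_)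
  · rw [hfx, mul_zero, zero_sub] at hge
    linarith
  · have hS : ∀ t' ∈ Θ₀, ∑ j, ∫ y in Metric.closedBall x (r n), |pd f j t' y| ≤
        c * (law (f t')).real (Metric.closedBall x (r n)) := by
      intro t' ht'
      have h1 : gradMass f t' (Metric.closedBall x (r n)) / law (f t') (Metric.closedBall x (r n)) ≤
          c := (gradMass_div_le ht' (x, r n)).trans hn.le
      have hlt := M.law_closedBall_ne_top ht' (Metric.closedBall x (r n))
      rw [ENNReal.div_le_iff_le_mul (Or.inr ENNReal.coe_ne_top) (Or.inl hlt)] at h1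
      have h2 := ENNReal.toReal_mono (ENNReal.mul_ne_top ENNReal.coe_ne_top hlt) h1
      rw [ENNReal.toReal_mul, ENNReal.coe_toReal, gradMass, ENNReal.toReal_sum] at h2
      · refine le_trans (le_of_eq (Finset.sum_congr rfl fun j _ => ?_)) h2
        exact integral_norm_eq_lintegral_enorm (M.continuous_pd ht' j).aestronglyMeasurable
      · intro j _
        have h3 : gradMass f t' (Metric.closedBall x (r n)) ≠ ∞ :=
          ne_top_of_le_ne_top (ENNReal.mul_ne_top ENNReal.coe_ne_top hlt) h1
        exact (ENNReal.sum_ne_top.1 h3) j (Finset.mem_univ j)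
    have h4 := M.law_real_le_exp_mul hD hθ x (r n) hS
    have hV : 0 ≤ (volume.real (Metric.closedBall x (r n)))⁻¹ := inv_nonneg.2 measureReal_nonneg
    have h5 := mul_le_mul_of_nonneg_left h4 hV
    simp only [ge_iff_le, sub_nonneg]
    linarith

end RegularModel

end GMSP

namespace GMSP

/-! ### Uniform convergence of the expectations -/

theorem _root_.ENNReal.exists_pos_mul_le {c ε : ℝ≥0∞} (hc : c ≠ ∞) (hε : 0 < ε) :
    ∃ δ, 0 < δ ∧ c * δ ≤ ε := by
  obtain ⟨δ, h0, h⟩ := ENNReal.exists_nnreal_pos_mul_lt hc hε.ne'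
  exact ⟨δ, by exact_mod_cast h0, by rw [mul_comm]; exact h.le⟩

variable {d q : ℕ} {f : EuclideanSpace ℝ (Fin q) → EuclideanSpace ℝ (Fin d) → ℝ}
  {θ₀ θ : EuclideanSpace ℝ (Fin q)} {Θ₀ : Set (EuclideanSpace ℝ (Fin q))}
  {Ω : Type*} [MeasurableSpace Ω] {μ : Measure Ω} [IsProbabilityMeasure μ]
  {ξ : ℕ → Ω → EuclideanSpace ℝ (Fin d)}

namespace RegularModel

/-- The two parts of `enorm_ballPsi_le` have different sources of domination: the scores for the
first, the averages of `(1 + gradSup)²` for the second. Both `a` and `b n` are independent of `θ`.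
-/
theorem exists_ballPsi_dominated (hd : 0 < d) (M : RegularModel f θ₀ Θ₀)
    (hmeas : ∀ i, Measurable (ξ i)) (hindep : iIndepFun ξ μ)
    (hlaw : ∀ i, μ.map (ξ i) = law (f θ₀)) {h : ℝ → ℝ} {C c₀ : ℝ≥0}
    (hv : ∀ z, 0 < z → |v h z| ≤ C * (c₀ + z + z ^ 2)) (hui : c₀ ≠ 0 → UnifIntScore μ ξ f Θ₀)
    {ε : ℝ≥0∞} (hε : 0 < ε) :
    ∃ (a : EuclideanSpace ℝ (Fin d) × ℝ → ℝ≥0∞) (b : ℕ → EuclideanSpace ℝ (Fin d) × ℝ → ℝ≥0∞),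
      Measurable a ∧ ∫⁻ p, a p ∂limitLaw f θ₀ < ∞ ∧ ∀ n, 2 ≤ n →
        ∫⁻ p, b n p ∂limitLaw f θ₀ ≤ ε ∧ ∀ θ ∈ Θ₀, ∀ᵐ p ∂limitLaw f θ₀,
          ‖ballPsi h f n θ (p.1, couplingRadius (law (f θ₀)) n p)‖ₑ ≤ a p + b n p := by
  have := (M.density θ₀ M.mem).isProbabilityMeasure_law
  have := isProbabilityMeasure_expMeasure one_pos
  have hP := law_sphere hd (f θ₀)
  have hprob : IsProbabilityMeasure (limitLaw f θ₀) := by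
    unfold limitLaw
    infer_instance
  obtain ⟨D, hD⟩ := M.exists_norm_sub_le
  obtain ⟨δ, hδ, hδε⟩ := ENNReal.exists_pos_mul_le
    (c := C * (c₀ + (1 + D))) (by finiteness) hε
  -- The factor `c₀` stays on both sides, so that nothing about the scores is needed when it
  -- vanishes.
  obtain ⟨K, b₁, hb₁⟩ : ∃ (K : ℝ≥0) (b : ℕ → EuclideanSpace ℝ (Fin d) × ℝ → ℝ≥0∞), ∀ n, 2 ≤ n →
      Measurable (b n) ∧ ∫⁻ p, b n p ∂limitLaw f θ₀ ≤ δ ∧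
      ∀ p, c₀ * couplingScore f θ₀ Θ₀ n p ≤ c₀ * (K + b n p) := by
    rcases eq_or_ne c₀ 0 with hc | hc
    · exact ⟨0, fun _ _ => 0, fun n hn => ⟨measurable_const, by simp, by simp [hc]⟩⟩
    · obtain ⟨K, b, hb⟩ := M.exists_couplingScore_dominated hd hmeas hindep hlaw (hui hc) hδ
      refine ⟨K, b, fun n hn => ⟨(hb n hn).1, (hb n hn).2.1, fun p => ?_⟩⟩
      gcongr
      exact (hb n hn).2.2 p
  have hφ : Measurable fun y => (1 + gradSup f θ₀ Θ₀ y) ^ 2 :=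
    (measurable_const.add M.measurable_gradSup).pow_const 2
  obtain ⟨K₂, b₂, hb₂⟩ := exists_couplingAverage_dominated hP hφ M.lintegral_gradSup_sq_lt_top hδ
  set w : EuclideanSpace ℝ (Fin d) × ℝ → ℝ≥0∞ := fun p => ENNReal.ofReal ((1 + 2 * p.2) ^ 2)
    with hw
  have hwm : Measurable w := by fun_prop
  have hwfin : ∫⁻ p, w p ∂limitLaw f θ₀ < ∞ := by
    rw [limitLaw, lintegral_prod_symm' _ hwm]
    simpa [hw] using lintegral_sq_expMeasure_lt_top
  refine ⟨fun p => C * (c₀ * K + (1 + D) * (w p * K₂)),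
    fun n p => C * (c₀ * b₁ n p + (1 + D) * (w p * b₂ n p)), by fun_prop, ?_, fun n hn => ⟨?_, ?_⟩⟩
  · rw [lintegral_const_mul' _ _ (by finiteness), lintegral_add_left measurable_const,
      lintegral_const, measure_univ, lintegral_const_mul' _ _ (by finiteness),
      lintegral_mul_const' _ _ (by finiteness)]
    finiteness
  · rw [lintegral_const_mul' _ _ (by finiteness),
      lintegral_add_left ((hb₁ n hn).1.const_mul _),
      lintegral_const_mul' _ _ (by finiteness), lintegral_const_mul' _ _ (by finiteness)]
    calc _ ≤ C * (c₀ * δ + (1 + D) * δ) := by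
          gcongr
          exacts [(hb₁ n hn).2.1, (hb₂ n hn).1]
      _ = C * (c₀ + (1 + D)) * δ := by ring
      _ ≤ ε := hδε
  · intro θ hθ
    have hpos : ∀ᵐ p ∂limitLaw f θ₀, 0 < p.2 := ae_pos_snd
    filter_upwards [hpos] with p hp
    obtain ⟨x, t⟩ := p
    calc _ ≤ _ := M.enorm_ballPsi_le hθ hv (by omega) _
      _ ≤ C * (c₀ * (K + b₁ n (x, t)) + (1 + D) * (w (x, t) * (K₂ + b₂ n (x, t)))) := by
        refine mul_le_mul_right (add_le_add ((hb₁ n hn).2.2 (x, t)) ?_) _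
        refine (M.mul_gradMass_mul_le hd hD hθ hn x hp).trans ?_
        gcongr
        exact (hb₂ n hn).2 (x, t) hp
      _ = _ := by ring

/-- The expectations converge uniformly as soon as `v` is continuous with `v z = O(c₀ + z + z²)`,
where `c₀ = 0` unless the scores are uniformly integrable. -/
theorem lamConvergesUniformly (hd : 0 < d) (M : RegularModel f θ₀ Θ₀)
    (hmeas : ∀ i, Measurable (ξ i)) (hindep : iIndepFun ξ μ)
    (hlaw : ∀ i, μ.map (ξ i) = law (f θ₀)) {h : ℝ → ℝ} {C c₀ : ℝ≥0}
    (hv : ∀ z, 0 < z → |v h z| ≤ C * (c₀ + z + z ^ 2)) (hvc : ContinuousOn (v h) (Set.Ioi 0))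
    (hui : c₀ ≠ 0 → UnifIntScore μ ξ f Θ₀) : LamConvergesUniformly μ ξ h f θ₀ Θ₀ := by
  have := (M.density θ₀ M.mem).isProbabilityMeasure_law
  have hP := law_sphere hd (f θ₀)
  have := isProbabilityMeasure_expMeasure one_pos
  let u : ℕ → EuclideanSpace ℝ (Fin q) → EuclideanSpace ℝ (Fin d) × ℝ → EuclideanSpace ℝ (Fin q) :=
    fun n θ p => ballPsi h f n θ (p.1, couplingRadius (law (f θ₀)) n p)
  have hum : ∀ n, 2 ≤ n → ∀ θ ∈ Θ₀, AEStronglyMeasurable (u n θ) (limitLaw f θ₀) :=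
    fun n hn θ hθ => ((M.measurable_ballPsi hθ h n).comp_measurable
      (M.measurable_coupling hd hn)).aestronglyMeasurable
  have hmΩ : ∀ n, Measurable fun ω => (ξ 0 ω, nnRadius (fun i => ξ i ω) n 0) := fun n =>
    (hmeas 0).prodMk (measurable_nnRadius hmeas n)
  have hpsiN : ∀ n θ, (fun ω => psiN h f n 0 (fun i => ξ i ω) θ) =
      fun ω => ballPsi h f n θ (ξ 0 ω, nnRadius (fun i => ξ i ω) n 0) := fun n θ => rfl
  have hint : ∀ n, 2 ≤ n → ∀ θ ∈ Θ₀, Integrable (u n θ) (limitLaw f θ₀) := by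
    intro n hn θ hθ
    obtain ⟨a, b, ham, ha, hb⟩ :=
      M.exists_ballPsi_dominated hd hmeas hindep hlaw hv hui one_pos
    refine ⟨hum n hn θ hθ, (lintegral_mono_ae ((hb n hn).2 θ hθ)).trans_lt ?_⟩
    rw [lintegral_add_left ham]
    exact ENNReal.add_lt_top.2 ⟨ha, (hb n hn).1.trans_lt ENNReal.one_lt_top⟩
  have hlam : ∀ n, 2 ≤ n → ∀ θ ∈ Θ₀, lamN μ ξ h f n θ = ∫ p, u n θ p ∂limitLaw f θ₀ := by
    intro n hn θ hθ
    rw [lamN, hpsiN, ← integral_map (hmΩ n).aemeasurable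
      (M.measurable_ballPsi hθ h n).aestronglyMeasurable,
      map_nnRadius_eq hP hmeas hindep hlaw hn, integral_map
        (M.measurable_coupling hd hn).aemeasurable
        (M.measurable_ballPsi hθ h n).aestronglyMeasurable]
    rfl
  have hseq : ∀ (n : ℕ → ℕ) (s : ℕ → EuclideanSpace ℝ (Fin q)) (θ : EuclideanSpace ℝ (Fin q)),
      (∀ k, 2 ≤ n k) → Tendsto n atTop atTop → (∀ k, s k ∈ Θ₀) → θ ∈ Θ₀ →
      Tendsto s atTop (𝓝 θ) → Integrable (fun p => psi h f θ₀ p.1 p.2 θ) (limitLaw f θ₀) ∧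
        Tendsto (fun k => lamN μ ξ h f (n k) (s k)) atTop (𝓝 (lam h f θ₀ θ)) := by
    intro n s θ hn2 hn hs hθ hlim
    have hpos1 : ∀ᵐ p ∂limitLaw f θ₀, 0 < f θ₀ p.1 :=
      Measure.quasiMeasurePreserving_fst.ae M.ae_pos
    have hpos2 : ∀ᵐ p ∂limitLaw f θ₀, 0 < p.2 := ae_pos_snd
    have hne : ∀ᵐ p ∂limitLaw f θ₀, c₀ ≠ 0 → f θ p.1 ≠ 0 := by
      rcases eq_or_ne c₀ 0 with hc | hc
      · exact Eventually.of_forall fun p h => absurd hc h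
      · filter_upwards [M.ae_ne_zero_of_unifIntScore hd hmeas hindep hlaw (hui hc) hθ] with p hp _
        exact hp
    obtain ⟨h1, h2⟩ := tendsto_integral_of_dominated_up_to (m := limitLaw f θ₀)
      (u := fun k => u (n k) (s k)) (w := fun p => psi h f θ₀ p.1 p.2 θ)
      (fun k => hum _ (hn2 k) _ (hs k)) (by
        filter_upwards [hpos1, hpos2, hne] with p hx ht hfx
        exact M.tendsto_ballPsi hd hv hvc hn2 hn hs hθ hlim hx ht hfx) (by
        intro ε hε
        obtain ⟨a, b, ham, ha, hb⟩ :=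
          M.exists_ballPsi_dominated hd hmeas hindep hlaw hv hui hε
        exact ⟨a, fun k => b (n k), ham.aemeasurable, ha, fun k => (hb _ (hn2 k)).1,
          fun k => (hb _ (hn2 k)).2 _ (hs k)⟩)
    exact ⟨h1, h2.congr fun k => (hlam _ (hn2 k) _ (hs k)).symm⟩
  refine ⟨fun n hn θ hθ => ?_, fun θ hθ => ?_, tendstoUniformlyOn_of_seq M.compact ?_⟩
  · rw [hpsiN]
    have h1 := (integrable_map_measure (M.measurable_ballPsi hθ h n).aestronglyMeasurable
      (M.measurable_coupling hd hn).aemeasurable).2 (hint n hn θ hθ)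
    have h2 : Integrable (ballPsi h f n θ)
        (μ.map fun ω => (ξ 0 ω, nnRadius (fun i => ξ i ω) n 0)) := by
      rw [map_nnRadius_eq hP hmeas hindep hlaw hn]
      exact h1
    exact h2.comp_measurable (hmΩ n)
  · exact (hseq (fun k => k + 2) (fun _ => θ) θ (fun k => by omega) (tendsto_add_atTop_nat 2)
      (fun _ => hθ) hθ tendsto_const_nhds).1
  · intro n s θ hn hs hθ hlim
    -- The coupling is set up for `n ≥ 2` only, so an initial segment is dropped.
    obtain ⟨N, hN⟩ := eventually_atTop.1 (hn.eventually (eventually_ge_atTop 2))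
    refine (tendsto_add_atTop_iff_nat N).1 ?_
    exact (hseq (fun k => n (k + N)) (fun k => s (k + N)) θ (fun k => hN _ (by omega))
      (hn.comp (tendsto_add_atTop_nat N)) (fun k => hs _) hθ
      (hlim.comp (tendsto_add_atTop_nat N))).2

end RegularModel

/-! ### The divergence functions -/

theorem v_h1 {z : ℝ} (hz : 0 < z) : v h1 z = 1 - z := by
  have : HasDerivAt h1 (z⁻¹ - 1) z :=
    ((Real.hasDerivAt_log hz.ne').sub (hasDerivAt_id z)).add_const 1
  rw [v, this.deriv]
  field_simp

theorem v_h2 {z : ℝ} (hz : 0 < z) : v h2 z = 1 - z - z * Real.log z := by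
  have : HasDerivAt h2 (-1 * Real.log z + (1 - z) * z⁻¹) z :=
    ((hasDerivAt_id z).const_sub 1).mul (Real.hasDerivAt_log hz.ne')
  rw [v, this.deriv]
  field_simp
  ring

theorem v_h5 (α : ℝ) {z : ℝ} (hz : 0 < z) :
    v (h5 α) z = Real.sign (1 - α) * (α * (z ^ α - z)) := by
  have : HasDerivAt (h5 α) (Real.sign (1 - α) * (α * z ^ (α - 1) - α * 1)) z :=
    ((((Real.hasDerivAt_rpow_const (Or.inl hz.ne')).sub
      ((hasDerivAt_id z).const_mul α)).add_const α).sub_const 1).const_mul _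
  rw [v, this.deriv, Real.rpow_sub_one hz.ne']
  field_simp

theorem abs_v_h1_le {z : ℝ} (hz : 0 < z) : |v h1 z| ≤ 1 + z + z ^ 2 := by
  rw [v_h1 hz, abs_le]
  constructor <;> nlinarith

/-- `z log z` lies between `z - 1` and `z² - z`. -/
theorem abs_v_h2_le {z : ℝ} (hz : 0 < z) : |v h2 z| ≤ 2 * (1 + z + z ^ 2) := by
  have h1 := mul_le_mul_of_nonneg_left (Real.log_le_sub_one_of_pos hz) hz.le
  have h2 := mul_le_mul_of_nonneg_left (Real.one_sub_inv_le_log_of_pos hz) hz.le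
  rw [mul_sub, mul_inv_cancel₀ hz.ne'] at h2
  rw [v_h2 hz, abs_le]
  constructor <;> nlinarith

theorem abs_v_h5_le {α : ℝ} (hα : 0 ≤ α) {z : ℝ} (hz : 0 < z) :
    |v (h5 α) z| ≤ α * (z ^ α + z) := by
  have hsign : |Real.sign (1 - α)| ≤ 1 := by
    rcases Real.sign_apply_eq (1 - α) with h | h | h <;> simp [h]
  have hz' : 0 < z ^ α := Real.rpow_pos_of_pos hz α
  rw [v_h5 α hz, abs_mul, abs_mul, abs_of_nonneg hα]
  have h1 : |z ^ α - z| ≤ z ^ α + z := abs_le.2 ⟨by linarith, by linarith⟩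
  calc _ ≤ 1 * (α * |z ^ α - z|) := by gcongr
    _ ≤ _ := by rw [one_mul]; gcongr

theorem continuousOn_v_h1 : ContinuousOn (v h1) (Set.Ioi 0) :=
  ContinuousOn.congr (f := fun z => 1 - z) (by fun_prop) fun _ hz => v_h1 hz

theorem continuousOn_v_h2 : ContinuousOn (v h2) (Set.Ioi 0) := by
  refine ContinuousOn.congr (f := fun z => 1 - z - z * Real.log z) ?_ fun _ hz => v_h2 hz
  exact (by fun_prop : Continuous fun z : ℝ => 1 - z).continuousOn.sub
    (continuousOn_id.mul (Real.continuousOn_log.mono fun z hz => ne_of_gt hz))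

theorem continuousOn_v_h5 (α : ℝ) : ContinuousOn (v (h5 α)) (Set.Ioi 0) := by
  refine ContinuousOn.congr (f := fun z => Real.sign (1 - α) * (α * (z ^ α - z))) ?_
    fun _ hz => v_h5 α hz
  exact continuousOn_const.mul (continuousOn_const.mul
    ((continuousOn_id.rpow_const fun z hz => Or.inl (ne_of_gt hz)).sub continuousOn_id))

theorem rpow_le_one_add {α z : ℝ} (hα0 : 0 ≤ α) (hα1 : α ≤ 1) (hz : 0 < z) : z ^ α ≤ 1 + z := by
  rcases le_total z 1 with h | h
  · linarith [Real.rpow_le_one hz.le h hα0]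
  · have := Real.rpow_le_rpow_of_exponent_le h hα1
    rw [Real.rpow_one] at this
    linarith

/-- For exponents in `[1, 2]` no constant term is needed; this is what permits `c₀ = 0`. -/
theorem rpow_le_add_sq {α z : ℝ} (hα1 : 1 ≤ α) (hα2 : α ≤ 2) (hz : 0 < z) :
    z ^ α ≤ z + z ^ 2 := by
  rcases le_total z 1 with h | h
  · have := Real.rpow_le_rpow_of_exponent_ge hz h hα1
    rw [Real.rpow_one] at this
    nlinarith
  · have := Real.rpow_le_rpow_of_exponent_le h hα2
    rw [Real.rpow_two] at this
    linarith

end GMSP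

theorem lemma1 {d q : ℕ} (hd : 0 < d)
    {Ω : Type*} [MeasurableSpace Ω] (μ : Measure Ω) [IsProbabilityMeasure μ]
    (Θ Θ₀ : Set (EuclideanSpace ℝ (Fin q))) (θ₀ : EuclideanSpace ℝ (Fin q))
    (f : EuclideanSpace ℝ (Fin q) → EuclideanSpace ℝ (Fin d) → ℝ)
    (ξ : ℕ → Ω → EuclideanSpace ℝ (Fin d))
    -- the model
    (hf : ∀ θ ∈ Θ, GMSP.IsDensity (f θ))
    -- the neighbourhood `Θ₀` of the true parameter, an interior point of `Θ`
    (hΘ₀ : Θ₀ ∈ 𝓝 θ₀) (hsub : Θ₀ ⊆ interior Θ) (hcomp : IsCompact Θ₀) (hconv : Convex ℝ Θ₀)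
    -- the densities vanish where the true density does
    (hac : ∀ θ ∈ Θ₀, GMSP.law (f θ) ≪ GMSP.law (f θ₀))
    -- independent observations with the true density
    (hmeas : ∀ i, Measurable (ξ i)) (hindep : iIndepFun ξ μ)
    (hlaw : ∀ i, μ.map (ξ i) = GMSP.law (f θ₀))
    -- the assumptions common to both cases
    (hsmooth : GMSP.SmoothFamily f Θ₀) (hsq : GMSP.SquareIntegrableSup f θ₀ Θ₀) :
    (GMSP.UnifIntScore μ ξ f Θ₀ →
      GMSP.LamConvergesUniformly μ ξ GMSP.h1 f θ₀ Θ₀ ∧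
      GMSP.LamConvergesUniformly μ ξ GMSP.h2 f θ₀ Θ₀ ∧
      ∀ α ∈ Set.Ioo (0 : ℝ) 1, GMSP.LamConvergesUniformly μ ξ (GMSP.h5 α) f θ₀ Θ₀) ∧
    (∀ α ∈ Set.Ioc (1 : ℝ) 2, GMSP.LamConvergesUniformly μ ξ (GMSP.h5 α) f θ₀ Θ₀) := by
  have M : GMSP.RegularModel f θ₀ Θ₀ :=
    { density := fun θ hθ => hf θ (interior_subset (hsub hθ))
      mem := mem_of_mem_nhds hΘ₀
      compact := hcomp
      convex := hconv
      ac := hac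
      smooth := hsmooth
      sq := hsq
      pd_eq_zero := fun θ hθ x j => GMSP.pd_eq_zero_of_eq_zero hf (hsub hθ) j }
  refine ⟨fun hui => ⟨?_, ?_, fun α hα => ?_⟩, fun α hα => ?_⟩
  · exact M.lamConvergesUniformly hd hmeas hindep hlaw (C := 1) (c₀ := 1)
      (fun z hz => by simpa using GMSP.abs_v_h1_le hz) GMSP.continuousOn_v_h1 fun _ => hui
  · exact M.lamConvergesUniformly hd hmeas hindep hlaw (C := 2) (c₀ := 1)
      (fun z hz => by simpa using GMSP.abs_v_h2_le hz) GMSP.continuousOn_v_h2 fun _ => hui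
  · refine M.lamConvergesUniformly hd hmeas hindep hlaw (C := 2) (c₀ := 1)
      (fun z hz => ?_) (GMSP.continuousOn_v_h5 α) fun _ => hui
    have h1 := GMSP.abs_v_h5_le hα.1.le hz
    have h2 := GMSP.rpow_le_one_add hα.1.le hα.2.le hz
    simp only [NNReal.coe_ofNat, NNReal.coe_one]
    nlinarith [hα.1, hα.2, sq_nonneg z]
  -- `α (z^α + z) ≤ 2 (2z + z²) ≤ 4 (z + z²)`. With `c₀ = 0` the hypothesis on the scores is
  -- vacuous.
  · refine M.lamConvergesUniformly hd hmeas hindep hlaw (C := 4) (c₀ := 0)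
      (fun z hz => ?_) (GMSP.continuousOn_v_h5 α) fun h => absurd rfl h
    have h1 := GMSP.abs_v_h5_le (α := α) (by linarith [hα.1]) hz
    have h2 := GMSP.rpow_le_add_sq hα.1.le hα.2 hz
    have h3 : 0 < z ^ α := Real.rpow_pos_of_pos hz α
    simp only [NNReal.coe_ofNat, NNReal.coe_zero]
    nlinarith [hα.1, hα.2, sq_nonneg z]
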